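/- Proposition (wave packet representation). Let $n\ge 1$. Write $e^{it\Delta}$ for the Fourier multiplier $e^{-it|\xi|^2}$ on $L^2(\mathbb R^n)$. For a normed space $H$, let $V^2H$ be the space of continuous functions $f:[0,1]\to H$ with finite norm $$\|f\|_{V^2H}^2=\sup_{t\in[0,1]}\|f(t)\|_H^2+\sup_{0\le t_0\le\dots\le t_m\le 1}\ \sum_{i<m}\|f(t_{i+1})-f(t_i)\|_H^2 ,$$ and write $V^2=V^2\mathbb C$. Fix a smooth, compactly supported $\phi:\mathbb R^n\to\mathbb R$ with $\sum_{k\in\mathbb Z^n}\phi_k=1$, where $\phi_k(x)=\phi(x-k)$. Let $X$ be the space of functions $u:[0,1]\to L^2(\mathbb R^n)$ such that $\phi_k e^{it\Delta}u\in V^2L^2$ for all $k$ and $$\|u\|_X^2=\sum_{k\in\mathbb Z^n}\|\phi_k\,e^{it\Delta}u\|_{V^2L^2}^2<\infty .$$ Let $\|f\|_{H^{N,N}}=\|\langle D\rangle^N f\|_{L^2}+\|\langle x\rangle^N f\|_{L^2}$, with $\langle y\rangle=(1+|y|^2)^{1/2}$. Let $R>0$. Then there are smooth, compactly supported functions $\chi^j:\mathbb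 R^n\to\mathbb C$ $(j=0,1,2,\dots)$ and finite constants $C_N$ $(N=0,1,2,\dots)$, depending only on $n,\phi,R$, with the following properties. 1. Every $\chi^j$ is supported in the ball $B(0,2)$ of the maximum norm and, if $n\le 15$, also in the Euclidean ball $B(0,2)$. Moreover $\|\chi^j\|_{H^{N,N}}\le C_N$ for all $N,j$. 2. Let $\xi_0\in\mathbb R^n$, and let $u_{\xi_0}\in X$ be localized at frequency $\xi_0$ on the unit scale, that is, for each $t\in[0,1]$ the spatial Fourier transform of $u_{\xi_0}(t)$ vanishes almost everywhere outside $\{|\xi-\xi_0|\le R\}$. Let $T_{\xi_0}$ be the set of the tubes $Q$ around the rays $t\mapsto x_Q-2t\xi_0$, $x_Q\in\mathbb Z^n$. Then there are $a^j_Q\in V^2$ $(j\ge 0,\ Q\in T_{\xi_0})$ such that, for every $t\in[0,1]$, $$u_{\xi_0}(t,x)=\sum_{j\ge 0}e^{ix\cdot\xi_0}e^{it|\xi_0|^2}\sum_{Q\in T_{\xi_0}}a^j_Q(t)\,\chi^j\bigl(x-(x_Q-2t\xi_0)\bigr),$$ with unconditional convergence in $L^2(\mathbb R^n)$ of the double series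 over $(j,Q)$, and, for all $N$ and $j$, $$\sum_{Q\in T_{\xi_0}}\|a^j_Q\|_{V^2}^2\le C_N\,(1+j)^{-N}\,\|u_{\xi_0}\|_X^2 .$$ If moreover every $\phi_k e^{it\Delta}u_{\xi_0}$ lies in the closure of the smooth functions in $V^2L^2$, then every $a^j_Q$ lies in the closure of the smooth functions in $V^2$. -/

import Mathlib

open MeasureTheory Set Filter Topology
open scoped ENNReal NNReal ContDiff FourierTransform

noncomputable section

namespace WavePacket

/-- Euclidean space `ℝⁿ`. -/
abbrev E (n : ℕ) := EuclideanSpace ℝ (Fin n)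

/-- The complex Hilbert space `L²(ℝⁿ)`. -/
abbrev L2 (n : ℕ) := Lp ℂ 2 (volume : Measure (E n))

/-- The lattice point of `ℤⁿ ⊆ ℝⁿ` with coordinates `k`. -/
def latticePt {n : ℕ} (k : Fin n → ℤ) : E n := WithLp.toLp 2 (fun i => (k i : ℝ))

open Classical in
/-- The class in `L²` of a square integrable function (and `0` for any other function). -/
def toL2 {n : ℕ} (f : E n → ℂ) : L2 n :=
  if h : MemLp f 2 volume then h.toLp f else 0

theorem toL2_coe {n : ℕ} {f : E n → ℂ} (h : MemLp f 2 volume) : toL2 f =ᵐ[volume] f := by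
  rw [toL2, dif_pos h]
  exact h.coeFn_toLp

/-- Multiplication of `f ∈ L²` by a bounded function `m`. -/
def mulL2 {n : ℕ} (m : E n → ℂ) (f : L2 n) : L2 n := toL2 (fun x => m x * f x)

theorem mulL2_coe {n : ℕ} {m : E n → ℂ} (hm : AEStronglyMeasurable m volume) {B : ℝ}
    (hB : ∀ x, ‖m x‖ ≤ B) (f : L2 n) : mulL2 m f =ᵐ[volume] fun x => m x * f x := by
  apply toL2_coe
  refine MemLp.of_le_mul (c := B) (Lp.memLp f) (hm.mul (Lp.aestronglyMeasurable f)) ?_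
  filter_upwards with x
  rw [norm_mul]
  exact mul_le_mul_of_nonneg_right (hB x) (norm_nonneg _)

/-- The Schrödinger group `e^{itΔ}` on `L²(ℝⁿ)`: the Fourier multiplier `e^{-it|ξ|²}`. Mathlib's
Fourier transform uses the character `e^{-2πi x·ζ}`, so that `ξ = 2πζ`. -/
def schrodinger {n : ℕ} (t : ℝ) (f : L2 n) : L2 n :=
  𝓕⁻ (mulL2 (fun ζ => Complex.exp (-(Complex.I * t * (‖(2 * Real.pi) • ζ‖ : ℂ) ^ 2))) (𝓕 f))

/-- The norm of `H^{N,N}_{0,0}`: `‖⟨D⟩^N f‖_{L²} + ‖⟨x⟩^N f‖_{L²}`, possibly infinite, where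
`⟨y⟩ = (1+|y|²)^{1/2}`. -/
def hNorm {n : ℕ} (N : ℕ) (f : L2 n) : ℝ≥0∞ :=
  eLpNorm (fun ζ => (Real.sqrt (1 + ‖(2 * Real.pi) • ζ‖ ^ 2) : ℂ) ^ N * (𝓕 f : L2 n) ζ) 2 volume
    + eLpNorm (fun x => (Real.sqrt (1 + ‖x‖ ^ 2) : ℂ) ^ N * f x) 2 volume

/-- A smooth compactly supported `φ` whose translates by `ℤⁿ` form a partition of unity. -/
structure IsLatticePartition {n : ℕ} (φ : E n → ℝ) : Prop where
  contDiff : ContDiff ℝ ∞ φ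
  hasCompactSupport : HasCompactSupport φ
  hasSum_one : ∀ x, HasSum (fun k : Fin n → ℤ => φ (x - latticePt k)) 1

section V2

variable {H : Type*} [NormedAddCommGroup H]

/-- The square of the (inhomogeneous) `V²` norm of an `H`-valued function on `[0,1]`:
the square of its supremum norm plus the square of its 2-variation. -/
def v2NormSq (f : ℝ → H) : ℝ≥0∞ :=
  (⨆ t ∈ Icc (0 : ℝ) 1, ‖f t‖ₑ ^ 2) +
    ⨆ p : ℕ × {τ : ℕ → ℝ // Monotone τ ∧ ∀ i, τ i ∈ Icc (0 : ℝ) 1},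
      ∑ i ∈ Finset.range p.1, ‖f (p.2.1 (i + 1)) - f (p.2.1 i)‖ₑ ^ 2

/-- Continuous functions on `[0,1]` of bounded 2-variation. -/
def MemV2 (f : ℝ → H) : Prop :=
  ContinuousOn f (Icc 0 1) ∧ v2NormSq f < ⊤

/-- The closure, in the `V²` norm, of the smooth functions on `[0,1]`. -/
def MemV2Closure [NormedSpace ℝ H] (f : ℝ → H) : Prop :=
  MemV2 f ∧ ∀ ε : ℝ≥0∞, 0 < ε →
    ∃ g : ℝ → H, ContDiffOn ℝ ∞ g (Icc 0 1) ∧ v2NormSq (fun t => f t - g t) ≤ ε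

end V2

/-- The localization `t ↦ φ_k e^{itΔ} u(t)`, with `φ_k(x) = φ(x - k)`. -/
def piece {n : ℕ} (φ : E n → ℝ) (u : ℝ → L2 n) (k : Fin n → ℤ) (t : ℝ) : L2 n :=
  mulL2 (fun x => (φ (x - latticePt k) : ℂ)) (schrodinger t (u t))

/-- `‖u‖_X² = ∑_{k ∈ ℤⁿ} ‖φ_k e^{itΔ} u‖²_{V² L²}`, for `u` on `[0,1] × ℝⁿ`. -/
def xNormSq {n : ℕ} (φ : E n → ℝ) (u : ℝ → L2 n) : ℝ≥0∞ :=
  ∑' k : Fin n → ℤ, v2NormSq (piece φ u k)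

/-- The space `X`. -/
def MemX {n : ℕ} (φ : E n → ℝ) (u : ℝ → L2 n) : Prop :=
  (∀ k, MemV2 (piece φ u k)) ∧ xNormSq φ u < ⊤

/-- The space `X` built on the closure of the smooth functions in `V²`. -/
def MemXClosure {n : ℕ} (φ : E n → ℝ) (u : ℝ → L2 n) : Prop :=
  (∀ k, MemV2Closure (piece φ u k)) ∧ xNormSq φ u < ⊤

/-- For every `t ∈ [0,1]`, the spatial Fourier transform of `u(t)` is supported in the closed ball
of radius `R` about the frequency `ξ₀`. -/
def FrequencyLocalized {n : ℕ} (R : ℝ) (ξ₀ : E n) (u : ℝ → L2 n) : Prop :=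
  ∀ t ∈ Icc (0 : ℝ) 1, ∀ᵐ ζ : E n, R < ‖(2 * Real.pi) • ζ - ξ₀‖ → (𝓕 (u t) : L2 n) ζ = 0

/-- The wave packet `e^{ix·ξ₀} e^{it|ξ₀|²} a(t) χ(x - (k - 2tξ₀))`, on the tube around the ray
`t ↦ k - 2tξ₀` that issues from the lattice point `k`. -/
def packet {n : ℕ} (ξ₀ : E n) (a : ℝ → ℂ) (χ : E n → ℂ) (k : Fin n → ℤ) (t : ℝ) (x : E n) : ℂ :=
  Complex.exp (Complex.I * (inner ℝ x ξ₀ : ℝ)) * Complex.exp (Complex.I * t * (‖ξ₀‖ : ℂ) ^ 2)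
    * a t * χ (x - (latticePt k - (2 * t) • ξ₀))

end WavePacket

end

/-! Put v = e^{itΔ}u and ξ = ξ₀ + η. Since |ξ|² = |η|² + 2η·ξ₀ + |ξ₀|², the demodulated function
e^{-ix·ξ₀} e^{-it|ξ₀|²} u(t,x), read in the moving coordinate y = x + 2tξ₀, is a Fourier integral of
e^{iy·η} e^{it|η|²} v̂(t, ξ₀ + η) over |η| ≤ R. It is therefore entire in y, and its Taylor series
about every lattice point l has the same sum. Multiplying the series about l by a bump centred at l,
and summing over l with bumps that form a partition of unity, gives the packets: the profiles are
bump times monomial, one j for each multi-index α, and the amplitudes are Taylor coefficients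
(`hasSum_taylorCoeff`, `hasSum_packet`).

The amplitudes lie in V² because the moving frame has removed the large linear phase 2tη·ξ₀. Each
amplitude pairs v(t) with a vector whose symbol carries only the phase |η|² on a bounded set of η.
For t in [0,1] this vector is, up to the modulation e^{ix·ξ₀}, concentrated near l and Lipschitz in
t, uniformly in ξ₀ (`exists_norm_cell_testVec_le`). A Lipschitz factor preserves V²
(`v2NormSq_tsum_inner_le`), and the decay in l - k lets the pieces φ_k v be summed by Schur's test
(`exists_taylorCoeff_bound`).

Rapid decay in j comes from the factor Λ^{|α|}/α! with Λ = 2(R+1), which beats every power of |α|,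
together with an enumeration of multi-indices in which j is polynomially bounded by |α|
(`exists_taylorSize_decay`, `exists_multiIndex_equiv`). The profiles are bounded uniformly in α
because the bumps live in |x_i| ≤ 0.51 < 1, where derivatives of high monomials stay bounded.
Convergence in L² follows from pointwise convergence, bounded overlap and a weighted Cauchy-Schwarz
inequality (`tendsto_eLpNorm_sub_sum`). -/

noncomputable section
namespace WavePacket

/-! ### Series of pairings in V². -/

section

/-- Weighted Cauchy-Schwarz inequality for series in `[0,∞]`. -/
theorem tsum_mul_sq_le {ι : Type*} (c x : ι → ℝ≥0∞) :
    (∑' k, c k * x k) ^ 2 ≤ (∑' k, c k) * ∑' k, c k * x k ^ 2 := by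
  have hfin : ∀ s : Finset ι, (∑ k ∈ s, c k * x k) ^ 2 ≤ (∑' k, c k) * ∑' k, c k * x k ^ 2 := by
    intro s
    have h := ENNReal.inner_le_Lp_mul_Lq s (fun k => c k ^ (1 / 2 : ℝ))
      (fun k => c k ^ (1 / 2 : ℝ) * x k) (p := 2) (q := 2) Real.HolderConjugate.two_two
    have e1 : ∀ k, c k ^ (1 / 2 : ℝ) * (c k ^ (1 / 2 : ℝ) * x k) = c k * x k := by
      intro k
      rw [← mul_assoc, ← ENNReal.rpow_add_of_nonneg _ _ (by norm_num) (by norm_num)]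
      norm_num
    have e2 : ∀ k, (c k ^ (1 / 2 : ℝ)) ^ (2 : ℝ) = c k := by
      intro k
      rw [← ENNReal.rpow_mul]; norm_num
    have e3 : ∀ k, (c k ^ (1 / 2 : ℝ) * x k) ^ (2 : ℝ) = c k * x k ^ 2 := by
      intro k
      rw [ENNReal.mul_rpow_of_nonneg _ _ (by norm_num), e2, ← ENNReal.rpow_natCast]
      norm_num
    simp only [e1, e2, e3] at h
    calc (∑ k ∈ s, c k * x k) ^ 2
        ≤ ((∑ k ∈ s, c k) ^ (1 / 2 : ℝ) * (∑ k ∈ s, c k * x k ^ 2) ^ (1 / 2 : ℝ)) ^ 2 := by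
          gcongr
      _ = (∑ k ∈ s, c k) * ∑ k ∈ s, c k * x k ^ 2 := by
          rw [← ENNReal.rpow_natCast, ENNReal.mul_rpow_of_nonneg _ _ (by norm_num),
            ← ENNReal.rpow_mul, ← ENNReal.rpow_mul]
          norm_num
      _ ≤ _ := by gcongr <;> exact ENNReal.sum_le_tsum s
  have ht : Tendsto (fun s : Finset ι => (∑ k ∈ s, c k * x k) ^ 2) atTop
      (𝓝 ((∑' k, c k * x k) ^ 2)) :=
    ((ENNReal.continuous_pow 2).tendsto _).comp ENNReal.summable.hasSum
  exact le_of_tendsto' ht hfin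

theorem ennreal_add_sq_le (a b : ℝ≥0∞) : (a + b) ^ 2 ≤ 2 * (a ^ 2 + b ^ 2) := by
  induction a with
  | top => simp
  | coe a =>
    induction b with
    | top => simp
    | coe b =>
      norm_cast
      rw [← NNReal.coe_le_coe]
      push_cast
      nlinarith [sq_nonneg ((a : ℝ) - b)]

theorem enorm_le_tsum {ι : Type*} {f : ι → ℂ} {a : ℂ} (h : HasSum f a) : ‖a‖ₑ ≤ ∑' k, ‖f k‖ₑ := by
  refine le_of_tendsto ((continuous_enorm.tendsto _).comp h) (Eventually.of_forall fun s => ?_)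
  exact (enorm_sum_le s f).trans (ENNReal.sum_le_tsum s)

section

variable {H : Type*} [NormedAddCommGroup H]

theorem enorm_sq_le_v2NormSq (f : ℝ → H) {t : ℝ} (ht : t ∈ Icc (0 : ℝ) 1) :
    ‖f t‖ₑ ^ 2 ≤ v2NormSq f :=
  (le_iSup₂_of_le (f := fun t _ => ‖f t‖ₑ ^ 2) t ht le_rfl).trans le_self_add

end

section

variable {H : Type*} [NormedAddCommGroup H] [InnerProductSpace ℂ H] {ι : Type*}

/-- Pairing against a summable, uniformly Lipschitz family of vectors is bounded in `V²`. -/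
theorem v2NormSq_tsum_inner_le {G f : ι → ℝ → H} {c : ι → ℝ≥0} {A : ℝ≥0∞} {b : ℝ → ℂ}
    (hA : ∑' k, (c k : ℝ≥0∞) ≤ A)
    (hG : ∀ k, ∀ t ∈ Icc (0 : ℝ) 1, ‖G k t‖ ≤ c k)
    (hL : ∀ k, ∀ t ∈ Icc (0 : ℝ) 1, ∀ s ∈ Icc (0 : ℝ) 1, ‖G k t - G k s‖ ≤ c k * |t - s|)
    (hb : ∀ t ∈ Icc (0 : ℝ) 1, HasSum (fun k => inner ℂ (G k t) (f k t)) (b t)) :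
    v2NormSq b ≤ 3 * A * ∑' k, c k * v2NormSq (f k) := by
  have hin : ∀ v w : H, ‖inner ℂ v w‖ₑ ≤ ‖v‖ₑ * ‖w‖ₑ := by
    intro v w
    rw [← ofReal_norm, ← ofReal_norm, ← ofReal_norm, ← ENNReal.ofReal_mul (norm_nonneg _)]
    exact ENNReal.ofReal_le_ofReal (norm_inner_le_norm v w)
  have hGe : ∀ k, ∀ t ∈ Icc (0 : ℝ) 1, ‖G k t‖ₑ ≤ c k := by
    intro k t ht
    rw [← ofReal_norm, ← ENNReal.ofReal_coe_nnreal]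
    exact ENNReal.ofReal_le_ofReal (hG k t ht)
  have hLe : ∀ k, ∀ t ∈ Icc (0 : ℝ) 1, ∀ s ∈ Icc (0 : ℝ) 1,
      ‖G k t - G k s‖ₑ ≤ c k * ENNReal.ofReal |t - s| := by
    intro k t ht s hs
    rw [← ofReal_norm, ← ENNReal.ofReal_coe_nnreal, ← ENNReal.ofReal_mul (NNReal.coe_nonneg _)]
    exact ENNReal.ofReal_le_ofReal (hL k t ht s hs)
  set V : ι → ℝ≥0∞ := fun k => ⨆ p : ℕ × {τ : ℕ → ℝ // Monotone τ ∧ ∀ i, τ i ∈ Icc (0 : ℝ) 1},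
      ∑ i ∈ Finset.range p.1, ‖f k (p.2.1 (i + 1)) - f k (p.2.1 i)‖ₑ ^ 2 with hV
  set S : ι → ℝ≥0∞ := fun k => ⨆ t ∈ Icc (0 : ℝ) 1, ‖f k t‖ₑ ^ 2 with hS
  have hfS : ∀ k, ∀ t ∈ Icc (0 : ℝ) 1, ‖f k t‖ₑ ^ 2 ≤ S k := fun k t ht =>
    le_iSup₂_of_le (f := fun t _ => ‖f k t‖ₑ ^ 2) t ht le_rfl
  have hsup : (⨆ t ∈ Icc (0 : ℝ) 1, ‖b t‖ₑ ^ 2) ≤ A * ∑' k, c k * S k := by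
    refine iSup₂_le fun t ht => ?_
    calc ‖b t‖ₑ ^ 2 ≤ (∑' k, c k * ‖f k t‖ₑ) ^ 2 := by
          gcongr
          refine (enorm_le_tsum (hb t ht)).trans (ENNReal.tsum_le_tsum fun k => ?_)
          exact (hin _ _).trans (by gcongr; exact hGe k t ht)
      _ ≤ (∑' k, (c k : ℝ≥0∞)) * ∑' k, c k * ‖f k t‖ₑ ^ 2 := tsum_mul_sq_le _ _
      _ ≤ A * ∑' k, c k * S k := by
          gcongr with k
          exact hfS k t ht
  have hinc : ∀ t ∈ Icc (0 : ℝ) 1, ∀ s ∈ Icc (0 : ℝ) 1, ‖b t - b s‖ₑ ^ 2 ≤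
      2 * A * ∑' k, c k * (‖f k t - f k s‖ₑ ^ 2 + ENNReal.ofReal |t - s| * S k) := by
    intro t ht s hs
    -- Since |t - s| ≤ 1, the squared Lipschitz increment is at most its first power, and first
    -- powers add up to at most 1 over a partition of [0,1].
    have hle1 : ENNReal.ofReal |t - s| ≤ 1 := by
      rw [ENNReal.ofReal_le_one, abs_le]
      constructor <;> linarith [ht.1, ht.2, hs.1, hs.2]
    calc ‖b t - b s‖ₑ ^ 2
        ≤ (∑' k, c k * (‖f k t - f k s‖ₑ + ENNReal.ofReal |t - s| * ‖f k s‖ₑ)) ^ 2 := by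
          gcongr
          refine (enorm_le_tsum ((hb t ht).sub (hb s hs))).trans (ENNReal.tsum_le_tsum fun k => ?_)
          have : inner ℂ (G k t) (f k t) - inner ℂ (G k s) (f k s) =
              inner ℂ (G k t) (f k t - f k s) + inner ℂ (G k t - G k s) (f k s) := by
            rw [inner_sub_right, inner_sub_left]; ring
          rw [this, mul_add, ← mul_assoc]
          refine (enorm_add_le _ _).trans (add_le_add ((hin _ _).trans ?_) ((hin _ _).trans ?_))
          · gcongr; exact hGe k t ht
          · gcongr; exact hLe k t ht s hs
      _ ≤ (∑' k, (c k : ℝ≥0∞)) *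
          ∑' k, c k * (‖f k t - f k s‖ₑ + ENNReal.ofReal |t - s| * ‖f k s‖ₑ) ^ 2 :=
          tsum_mul_sq_le _ _
      _ ≤ A * ∑' k, c k * (2 * (‖f k t - f k s‖ₑ ^ 2 + ENNReal.ofReal |t - s| * S k)) := by
          gcongr with k
          refine (ennreal_add_sq_le _ _).trans ?_
          rw [mul_pow]
          gcongr
          · exact pow_le_of_le_one zero_le hle1 two_ne_zero
          · exact hfS k s hs
      _ = _ := by
          simp_rw [mul_left_comm _ (2 : ℝ≥0∞), ENNReal.tsum_mul_left]
          ring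
  have hvar : (⨆ p : ℕ × {τ : ℕ → ℝ // Monotone τ ∧ ∀ i, τ i ∈ Icc (0 : ℝ) 1},
      ∑ i ∈ Finset.range p.1, ‖b (p.2.1 (i + 1)) - b (p.2.1 i)‖ₑ ^ 2) ≤
      2 * A * ∑' k, c k * (V k + S k) := by
    refine iSup_le fun p => ?_
    obtain ⟨m, τ, hτ, hτI⟩ := p
    dsimp only
    have hlen : ∑ i ∈ Finset.range m, ENNReal.ofReal |τ (i + 1) - τ i| ≤ 1 := by
      rw [← ENNReal.ofReal_sum_of_nonneg fun _ _ => abs_nonneg _, ENNReal.ofReal_le_one]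
      rw [Finset.sum_congr rfl fun i _ => abs_of_nonneg (sub_nonneg.2 (hτ (Nat.le_succ i))),
        Finset.sum_range_sub]
      linarith [(hτI m).2, (hτI 0).1]
    calc ∑ i ∈ Finset.range m, ‖b (τ (i + 1)) - b (τ i)‖ₑ ^ 2
        ≤ ∑ i ∈ Finset.range m, 2 * A * ∑' k, c k * (‖f k (τ (i + 1)) - f k (τ i)‖ₑ ^ 2 +
            ENNReal.ofReal |τ (i + 1) - τ i| * S k) :=
          Finset.sum_le_sum fun i _ => hinc _ (hτI _) _ (hτI _)
      _ = 2 * A * ∑' k, c k * (∑ i ∈ Finset.range m, ‖f k (τ (i + 1)) - f k (τ i)‖ₑ ^ 2 +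
            (∑ i ∈ Finset.range m, ENNReal.ofReal |τ (i + 1) - τ i|) * S k) := by
          rw [← Finset.mul_sum, ← Summable.tsum_finsetSum fun _ _ => ENNReal.summable]
          congr 2
          ext k
          rw [← Finset.mul_sum, Finset.sum_add_distrib, Finset.sum_mul]
      _ ≤ 2 * A * ∑' k, c k * (V k + S k) := by
          gcongr with k
          · exact le_iSup (fun p : ℕ × {τ : ℕ → ℝ // Monotone τ ∧ ∀ i, τ i ∈ Icc (0 : ℝ) 1} =>
              ∑ i ∈ Finset.range p.1, ‖f k (p.2.1 (i + 1)) - f k (p.2.1 i)‖ₑ ^ 2) ⟨m, τ, hτ, hτI⟩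
          · exact mul_le_of_le_one_left zero_le hlen
  calc v2NormSq b ≤ A * ∑' k, c k * S k + 2 * A * ∑' k, c k * (V k + S k) := add_le_add hsup hvar
    _ ≤ A * ∑' k, c k * v2NormSq (f k) + 2 * A * ∑' k, c k * v2NormSq (f k) := by
        gcongr with k k
        · exact le_self_add
        · exact (add_comm _ _).le
    _ = _ := by ring

/-- The V² bound controls the sup norm of every `f k`, so the summable `c` gives a Weierstrass
majorant. -/
theorem continuousOn_tsum_inner {G f : ι → ℝ → H} {c : ι → ℝ≥0} {A B : ℝ≥0∞} {b : ℝ → ℂ}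
    (hA : ∑' k, (c k : ℝ≥0∞) ≤ A) (hA' : A ≠ ⊤)
    (hG : ∀ k, ∀ t ∈ Icc (0 : ℝ) 1, ‖G k t‖ ≤ c k)
    (hL : ∀ k, ∀ t ∈ Icc (0 : ℝ) 1, ∀ s ∈ Icc (0 : ℝ) 1, ‖G k t - G k s‖ ≤ c k * |t - s|)
    (hb : ∀ t ∈ Icc (0 : ℝ) 1, HasSum (fun k => inner ℂ (G k t) (f k t)) (b t))
    (hB : B ≠ ⊤) (hfB : ∀ k, v2NormSq (f k) ≤ B) (hf : ∀ k, ContinuousOn (f k) (Icc 0 1)) :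
    ContinuousOn b (Icc 0 1) := by
  have hc : Summable fun k => (c k : ℝ) := by
    rw [NNReal.summable_coe, ← ENNReal.tsum_coe_ne_top_iff_summable]
    exact ne_top_of_le_ne_top hA' hA
  have hGc : ∀ k, ContinuousOn (G k) (Icc 0 1) := by
    intro k
    refine LipschitzOnWith.continuousOn (K := c k) (LipschitzOnWith.of_dist_le_mul ?_)
    intro t ht s hs
    rw [dist_eq_norm, Real.dist_eq]
    exact hL k t ht s hs
  have hfn : ∀ k, ∀ t ∈ Icc (0 : ℝ) 1, ‖f k t‖ ≤ 1 + B.toReal := by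
    intro k t ht
    have h1 : ‖f k t‖ ^ 2 ≤ B.toReal := by
      rw [← ENNReal.ofReal_le_iff_le_toReal hB, ENNReal.ofReal_pow (norm_nonneg _), ofReal_norm]
      exact (enorm_sq_le_v2NormSq (f k) ht).trans (hfB k)
    nlinarith [sq_nonneg (‖f k t‖ - 1), norm_nonneg (f k t)]
  have h := continuousOn_tsum (f := fun k t => inner ℂ (G k t) (f k t)) (s := Icc (0 : ℝ) 1)
    (fun k => (hGc k).inner (hf k)) (hc.mul_right (1 + B.toReal)) (by
      intro k t ht
      exact (norm_inner_le_norm _ _).trans (mul_le_mul (hG k t ht) (hfn k t ht) (norm_nonneg _)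
        (NNReal.coe_nonneg _)))
  exact h.congr fun t ht => (hb t ht).tsum_eq.symm

/-- Replacing finitely many `f k` by smooth approximants and dropping the rest leaves a finite
smooth sum. The error is again a series of pairings with the same `G`, so the V² bound applies to
it. -/
theorem memV2Closure_tsum_inner {G f : ι → ℝ → H} {c : ι → ℝ≥0} {A B : ℝ≥0∞} {b : ℝ → ℂ}
    (hA : ∑' k, (c k : ℝ≥0∞) ≤ A) (hA' : A ≠ ⊤)
    (hG : ∀ k, ∀ t ∈ Icc (0 : ℝ) 1, ‖G k t‖ ≤ c k)
    (hL : ∀ k, ∀ t ∈ Icc (0 : ℝ) 1, ∀ s ∈ Icc (0 : ℝ) 1, ‖G k t - G k s‖ ≤ c k * |t - s|)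
    (hb : ∀ t ∈ Icc (0 : ℝ) 1, HasSum (fun k => inner ℂ (G k t) (f k t)) (b t))
    (hbV : MemV2 b) (hB : B ≠ ⊤) (hfB : ∀ k, v2NormSq (f k) ≤ B)
    (hGs : ∀ k, ContDiff ℝ ∞ (G k)) (hf : ∀ k, MemV2Closure (f k)) :
    MemV2Closure b := by
  classical
  refine ⟨hbV, fun ε hε => ?_⟩
  wlog hεt : ε ≠ ⊤ generalizing ε
  · obtain ⟨g, hg, -⟩ := this 1 one_pos ENNReal.one_ne_top
    exact ⟨g, hg, by rw [not_not.1 hεt]; exact le_top⟩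
  have hsum : ∑' k, (c k : ℝ≥0∞) * v2NormSq (f k) ≠ ⊤ := by
    refine ne_top_of_le_ne_top (ENNReal.mul_ne_top hA' hB) ?_
    calc ∑' k, (c k : ℝ≥0∞) * v2NormSq (f k) ≤ ∑' k, (c k : ℝ≥0∞) * B := by
          gcongr with k; exact hfB k
      _ = (∑' k, (c k : ℝ≥0∞)) * B := ENNReal.tsum_mul_right
      _ ≤ A * B := by gcongr
  -- Error budget: the approximated indices contribute at most Aδ, the tail at most δ, and the V²
  -- bound multiplies both by 3A.
  obtain ⟨δ, hδ, hδε⟩ : ∃ δ : ℝ≥0∞, 0 < δ ∧ 3 * A * (A * δ + δ) ≤ ε := by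
    refine ⟨ε / (3 * A * (A + 1) + 1), ENNReal.div_pos hε.ne' ?_, ?_⟩
    · finiteness
    · calc 3 * A * (A * (ε / (3 * A * (A + 1) + 1)) + ε / (3 * A * (A + 1) + 1))
          = (3 * A * (A + 1)) * (ε / (3 * A * (A + 1) + 1)) := by ring
        _ ≤ (3 * A * (A + 1) + 1) * (ε / (3 * A * (A + 1) + 1)) := by
          gcongr; exact le_self_add
        _ ≤ ε := ENNReal.mul_div_le
  obtain ⟨F, hF⟩ : ∃ F : Finset ι, ∑' k : {k // k ∉ F}, (c k : ℝ≥0∞) * v2NormSq (f k) < δ :=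
    ((ENNReal.tendsto_tsum_compl_atTop_zero hsum).eventually (gt_mem_nhds hδ)).exists
  choose g hg hgδ using fun k => (hf k).2 δ hδ
  set f' : ι → ℝ → H := fun k t => f k t - if k ∈ F then g k t else 0 with hf'
  refine ⟨fun t => ∑ k ∈ F, inner ℂ (G k t) (g k t), ?_, ?_⟩
  · exact ContDiffOn.sum fun k _ => (hGs k).contDiffOn.inner ℂ (hg k)
  · have hb' : ∀ t ∈ Icc (0 : ℝ) 1, HasSum (fun k => inner ℂ (G k t) (f' k t))
        (b t - ∑ k ∈ F, inner ℂ (G k t) (g k t)) := by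
      intro t ht
      have h1 : HasSum (fun k => if k ∈ F then (inner ℂ (G k t) (g k t) : ℂ) else 0)
          (∑ k ∈ F, inner ℂ (G k t) (g k t)) := by
        convert! hasSum_sum_of_ne_finset_zero (s := F)
          (f := fun k => if k ∈ F then (inner ℂ (G k t) (g k t) : ℂ) else 0) ?_ using 1
        · exact Finset.sum_congr rfl fun k hk => by simp [hk]
        · intro k hk; simp [hk]
        · infer_instance
      convert! (hb t ht).sub h1 using 2 with k
      by_cases hk : k ∈ F <;> simp [hf', hk]
    refine (v2NormSq_tsum_inner_le hA hG hL hb').trans (le_trans ?_ hδε)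
    gcongr 3 * A * ?_
    have hsplit : ∀ k, (c k : ℝ≥0∞) * v2NormSq (f' k) ≤
        c k * δ + (↑F : Set ι)ᶜ.indicator (fun k => (c k : ℝ≥0∞) * v2NormSq (f k)) k := by
      intro k
      by_cases hk : k ∈ F
      · have : f' k = fun t => f k t - g k t := by ext t; simp [hf', hk]
        rw [this]
        refine le_add_right ?_
        gcongr
        exact hgδ k
      · have : f' k = f k := by ext t; simp [hf', hk]
        rw [this, Set.indicator_of_mem (by simpa using hk)]
        exact le_add_self
    refine (ENNReal.tsum_le_tsum hsplit).trans ?_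
    rw [ENNReal.tsum_add, ENNReal.tsum_mul_right, ← tsum_subtype]
    gcongr
    exact hF.le

end
end

/-! ### The Fourier transform on L² and smooth curves of multipliers. -/

section

variable {n : ℕ}

/-- On `L¹ ∩ L²` the inverse Fourier transform of `L²` is given by the Fourier integral. -/
theorem fourierInv_ae_eq (f : L2 n) (hf : Integrable f) :
    (𝓕⁻ f : L2 n) =ᵐ[volume] 𝓕⁻ (f : E n → ℂ) := by
  have hcont : Continuous (𝓕⁻ (f : E n → ℂ)) := by
    have h : (𝓕⁻ (f : E n → ℂ)) = fun w => (𝓕 (f : E n → ℂ)) (-w) := by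
      ext w; rw [Real.fourierInv_eq_fourier_neg]
    rw [h]
    exact (VectorFourier.fourierIntegral_continuous Real.continuous_fourierChar
      (by exact continuous_inner) hf).comp continuous_neg
  -- Both sides are tested against smooth compactly supported functions: the L² transform acts there
  -- as a tempered distribution, and the Fourier integral of an L¹ function can be moved onto the
  -- test function.
  refine ae_eq_of_integral_contDiff_smul_eq ((Lp.memLp _).locallyIntegrable (by norm_num))
    hcont.locallyIntegrable fun g hg hgc => ?_
  have hg1 : HasCompactSupport fun x => (g x : ℂ) := hgc.comp_left Complex.ofReal_zero
  have hg2 : ContDiff ℝ ∞ fun x => (g x : ℂ) := Complex.ofRealCLM.contDiff.comp hg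
  set G : SchwartzMap (E n) ℂ := hg1.toSchwartzMap hg2 with hG
  have hGa : ∀ x, G x = g x := fun x => rfl
  have h1 := congrArg (fun T => T G) (Lp.fourierInv_toTemperedDistribution_eq f)
  simp only [TemperedDistribution.fourierInv_apply, Lp.toTemperedDistribution_apply] at h1
  have h2 : ∫ x, (𝓕⁻ G) x • f x = ∫ x, G x • (𝓕⁻ (f : E n → ℂ)) x := by
    have h := VectorFourier.integral_fourierIntegral_smul_eq_flip (μ := volume) (ν := volume)
      (L := -(innerₗ (E n))) (e := Real.fourierChar) (f := G) (g := f)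
      Real.continuous_fourierChar (by simpa using! continuous_inner.neg) G.integrable hf
    convert! h using 2
    · ext x
      rw [SchwartzMap.fourierInv_coe, Real.fourierInv_eq]
      simp [VectorFourier.fourierIntegral]
    · ext x
      rw [Real.fourierInv_eq]
      simp [VectorFourier.fourierIntegral, real_inner_comm]
  rw [h2] at h1
  simpa [hGa] using h1.symm

theorem exists_clm_mulL2 {m : E n → ℂ} (hm : AEStronglyMeasurable m volume) {B : ℝ}
    (hB : ∀ x, ‖m x‖ ≤ B) : ∃ T : L2 n →L[ℂ] L2 n, ∀ f, T f = mulL2 m f := by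
  refine ⟨LinearMap.mkContinuous
    { toFun := mulL2 m
      map_add' := fun f g => ?_
      map_smul' := fun c f => ?_ } B fun f => ?_, fun f => rfl⟩
  · apply Lp.ext
    filter_upwards [mulL2_coe hm hB (f + g), mulL2_coe hm hB f, mulL2_coe hm hB g,
      Lp.coeFn_add f g, Lp.coeFn_add (mulL2 m f) (mulL2 m g)] with x h1 h2 h3 h4 h5
    simp only [h1, h2, h3, h4, h5, Pi.add_apply, mul_add]
  · apply Lp.ext
    filter_upwards [mulL2_coe hm hB (c • f), mulL2_coe hm hB f, Lp.coeFn_smul c f,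
      Lp.coeFn_smul c (mulL2 m f)] with x h1 h2 h4 h5
    simp only [h1, h2, h4, h5, Pi.smul_apply, smul_eq_mul, RingHom.id_apply]
    ring
  · refine Lp.norm_le_mul_norm_of_ae_le_mul ?_
    filter_upwards [mulL2_coe hm hB f] with x h1
    simp only [LinearMap.coe_mk, AddHom.coe_mk, h1, norm_mul]
    exact mul_le_mul_of_nonneg_right (hB x) (norm_nonneg _)

theorem fourier_schrodinger (t : ℝ) (f : L2 n) : (𝓕 (schrodinger t f) : L2 n) =ᵐ[volume]
    fun ζ => Complex.exp (-(Complex.I * t * (‖(2 * Real.pi) • ζ‖ : ℂ) ^ 2)) * (𝓕 f : L2 n) ζ := by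
  rw [schrodinger, FourierTransform.fourier_fourierInv_eq]
  refine mulL2_coe (B := 1) (Continuous.aestronglyMeasurable (by fun_prop)) (fun ζ => ?_) _
  rw [Complex.norm_exp]
  simp [← Complex.ofReal_pow]

theorem memLp_mul_exp {q : E n → ℂ} {s : E n → ℝ} (hq : MemLp q 2 volume)
    (hs : Continuous s) (t : ℝ) :
    MemLp (fun x => q x * Complex.exp (-(Complex.I * t * s x))) 2 volume := by
  refine hq.mono (hq.1.mul (Continuous.aestronglyMeasurable (by fun_prop)))
    (Eventually.of_forall fun x => ?_)
  rw [norm_mul, Complex.norm_exp]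
  simp

/-- Where `q` does not vanish the phase is bounded, so |e^z - 1 - z| ≤ |z|² gives a second-order
remainder uniform in x, hence in L². -/
theorem hasDerivAt_toL2_mul_exp {q : E n → ℂ} {s : E n → ℝ} {B : ℝ} (hq : MemLp q 2 volume)
    (hs : Continuous s) (hB : ∀ x, q x ≠ 0 → |s x| ≤ B) (t : ℝ) :
    HasDerivAt (fun t : ℝ => toL2 (fun x => q x * Complex.exp (-(Complex.I * t * s x))))
      (toL2 (fun x => (-(Complex.I * s x) * q x) * Complex.exp (-(Complex.I * t * s x)))) t := by
  have hq' : MemLp (fun x => -(Complex.I * s x) * q x) 2 volume := by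
    refine MemLp.of_le_mul (c := B) hq (AEStronglyMeasurable.mul
      (Continuous.aestronglyMeasurable (by fun_prop)) hq.1) (Eventually.of_forall fun x => ?_)
    by_cases h : q x = 0
    · simp [h]
    · rw [norm_mul]
      gcongr
      simpa using hB x h
  rw [hasDerivAt_iff_isLittleO_nhds_zero]
  have hO : (fun h : ℝ => toL2 (fun x => q x * Complex.exp (-(Complex.I * (t + h : ℝ) * s x))) -
      toL2 (fun x => q x * Complex.exp (-(Complex.I * t * s x))) -
      h • toL2 (fun x => (-(Complex.I * s x) * q x) * Complex.exp (-(Complex.I * t * s x))))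
      =O[𝓝 0] fun h : ℝ => h ^ 2 := by
    refine Asymptotics.IsBigO.of_bound (B ^ 2 * ‖toL2 q‖) ?_
    have hsmall : ∀ᶠ h : ℝ in 𝓝 0, |h| * B < 1 := by
      have : ContinuousAt (fun h : ℝ => |h| * B) 0 := by fun_prop
      exact this.eventually (gt_mem_nhds (by simp))
    filter_upwards [hsmall] with h hh
    have key : ‖toL2 (fun x => q x * Complex.exp (-(Complex.I * (t + h : ℝ) * s x))) -
      toL2 (fun x => q x * Complex.exp (-(Complex.I * t * s x))) -
      h • toL2 (fun x => (-(Complex.I * s x) * q x) * Complex.exp (-(Complex.I * t * s x)))‖ ≤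
      (B ^ 2 * h ^ 2) * ‖toL2 q‖ := by
      refine Lp.norm_le_mul_norm_of_ae_le_mul ?_
      filter_upwards [toL2_coe hq, toL2_coe (memLp_mul_exp hq hs (t + h)),
        toL2_coe (memLp_mul_exp hq hs t), toL2_coe (memLp_mul_exp hq' hs t),
        Lp.coeFn_sub (toL2 (fun x => q x * Complex.exp (-(Complex.I * (t + h : ℝ) * s x))) -
          toL2 (fun x => q x * Complex.exp (-(Complex.I * t * s x))))
          (h • toL2 (fun x => (-(Complex.I * s x) * q x) *
            Complex.exp (-(Complex.I * t * s x)))),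
        Lp.coeFn_sub (toL2 (fun x => q x * Complex.exp (-(Complex.I * (t + h : ℝ) * s x))))
          (toL2 (fun x => q x * Complex.exp (-(Complex.I * t * s x)))),
        Lp.coeFn_smul h (toL2 (fun x => (-(Complex.I * s x) * q x) *
            Complex.exp (-(Complex.I * t * s x))))] with x h1 h2 h3 h4 h5 h6 h7
      rw [h5, Pi.sub_apply, h6, Pi.sub_apply, h7, Pi.smul_apply, h1, h2, h3, h4]
      by_cases hx : q x = 0
      · simp [hx]
      have e : q x * Complex.exp (-(Complex.I * (t + h : ℝ) * s x)) -
          q x * Complex.exp (-(Complex.I * t * s x)) -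
          h • ((-(Complex.I * s x) * q x) * Complex.exp (-(Complex.I * t * s x))) =
          q x * Complex.exp (-(Complex.I * t * s x)) *
          (Complex.exp (-(Complex.I * h * s x)) - 1 - (-(Complex.I * h * s x))) := by
        have : Complex.exp (-(Complex.I * (t + h : ℝ) * s x)) =
            Complex.exp (-(Complex.I * t * s x)) * Complex.exp (-(Complex.I * h * s x)) := by
          rw [← Complex.exp_add]; congr 1; push_cast; ring
        rw [this, Complex.real_smul]
        ring
      have hn : ‖-(Complex.I * h * s x)‖ = |h| * |s x| := by simp
      have hle : |h| * |s x| ≤ |h| * B := by gcongr; exact hB x hx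
      have h8 := Complex.norm_exp_sub_one_sub_id_le (x := -(Complex.I * h * s x))
        (by rw [hn]; linarith)
      have h9 : ‖Complex.exp (-(Complex.I * t * s x))‖ = 1 := by
        rw [Complex.norm_exp]; simp
      rw [e, norm_mul, norm_mul, h9, mul_one, mul_comm]
      gcongr
      refine h8.trans ?_
      rw [hn]
      calc (|h| * |s x|) ^ 2 ≤ (|h| * B) ^ 2 := by gcongr
        _ = B ^ 2 * h ^ 2 := by rw [mul_pow, sq_abs]; ring
    rw [Real.norm_eq_abs, abs_of_nonneg (sq_nonneg h)]
    linarith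
  exact hO.trans_isLittleO (by simpa using Asymptotics.isLittleO_pow_id (𝕜 := ℝ) one_lt_two)

/-- The derivative has the same form with `q` replaced by `-i s q`, which vanishes wherever `q`
does; hence induction on the order. -/
theorem contDiff_toL2_mul_exp {s : E n → ℝ} {B : ℝ} (hs : Continuous s)
    {q : E n → ℂ} (hq : MemLp q 2 volume) (hB : ∀ x, q x ≠ 0 → |s x| ≤ B) :
    ContDiff ℝ ∞ (fun t : ℝ => toL2 (fun x => q x * Complex.exp (-(Complex.I * t * s x)))) := by
  rw [contDiff_infty]
  intro N
  induction N generalizing q with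
  | zero =>
    rw [Nat.cast_zero, contDiff_zero, continuous_iff_continuousAt]
    exact fun t => (hasDerivAt_toL2_mul_exp hq hs hB t).continuousAt
  | succ N ih =>
    push_cast
    rw [contDiff_succ_iff_deriv]
    have hd := hasDerivAt_toL2_mul_exp hq hs hB
    refine ⟨fun t => (hd t).differentiableAt, by simp, ?_⟩
    rw [funext fun t => (hd t).deriv]
    refine ih ?_ fun x hx => hB x (right_ne_zero_of_mul hx)
    refine MemLp.of_le_mul (c := B) hq (AEStronglyMeasurable.mul
      (Continuous.aestronglyMeasurable (by fun_prop)) hq.1) (Eventually.of_forall fun x => ?_)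
    by_cases h : q x = 0
    · simp [h]
    · rw [norm_mul]
      gcongr
      simpa using hB x h

end

/-! ### One-dimensional oscillatory kernels. -/

section

/-- The one-dimensional symbol `ψ(η) η^a e^{itη²}`. -/
def symbol (ψ : ℝ → ℝ) (a : ℕ) (t η : ℝ) : ℂ :=
  ψ η * (η : ℂ) ^ a * Complex.exp (Complex.I * t * (η : ℂ) ^ 2)

/-- The one-dimensional kernel with symbol `ψ(η) η^a e^{itη²}`. -/
def kernel (ψ : ℝ → ℝ) (a : ℕ) (t x : ℝ) : ℂ :=
  ∫ η : ℝ, Complex.exp (Complex.I * x * η) * symbol ψ a t η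

theorem norm_exp_I_mul (x y : ℝ) : ‖Complex.exp (Complex.I * x * y)‖ = 1 := by
  rw [Complex.norm_exp]; simp

theorem norm_exp_I_mul_sq (x y : ℝ) : ‖Complex.exp (Complex.I * x * (y : ℂ) ^ 2)‖ = 1 := by
  exact_mod_cast norm_exp_I_mul x (y ^ (2 : ℕ))

theorem integrable_exp_mul {v : ℝ → ℂ} (hv : Continuous v) (hc : HasCompactSupport v) (x : ℝ) :
    Integrable fun η : ℝ => Complex.exp (Complex.I * x * η) * v η :=
  Continuous.integrable_of_hasCompactSupport (by fun_prop) hc.mul_left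

theorem mul_integral_exp_mul {v v' : ℝ → ℂ} (hv : ∀ η, HasDerivAt v (v' η) η)
    (hv' : Continuous v') (hc : HasCompactSupport v) (hc' : HasCompactSupport v') (x : ℝ) :
    Complex.I * x * ∫ η : ℝ, Complex.exp (Complex.I * x * η) * v η =
      -∫ η : ℝ, Complex.exp (Complex.I * x * η) * v' η := by
  have hvc : Continuous v := continuous_iff_continuousAt.2 fun η => (hv η).continuousAt
  have he : ∀ η : ℝ, HasDerivAt (fun η : ℝ => Complex.exp (Complex.I * x * η))
      (Complex.exp (Complex.I * x * η) * (Complex.I * x)) η := by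
    intro η
    have h : HasDerivAt (fun η : ℝ => Complex.I * x * (η : ℂ)) (Complex.I * x) η := by
      simpa using (Complex.ofRealCLM.hasDerivAt (x := η)).const_mul (Complex.I * (x : ℂ))
    exact h.cexp
  have h := integral_mul_deriv_eq_deriv_mul_of_integrable
    (fun η _ => he η) (fun η _ => hv η)
    (integrable_exp_mul hv' hc' x)
    (by
      have := (integrable_exp_mul hvc hc x).mul_const (Complex.I * (x : ℂ))
      refine this.congr (Eventually.of_forall fun η => ?_)
      simp only [Pi.mul_apply]; ring)
    (integrable_exp_mul hvc hc x)
  rw [h, neg_neg, ← integral_const_mul]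
  exact integral_congr_ae (Eventually.of_forall fun η => by ring)

theorem norm_integral_le_of_support {v : ℝ → ℂ} {ρ M : ℝ} (hρ : 0 ≤ ρ)
    (hs : ∀ η, ρ < |η| → v η = 0) (hM : ∀ η, |η| ≤ ρ → ‖v η‖ ≤ M) (x : ℝ) :
    ‖∫ η : ℝ, Complex.exp (Complex.I * x * η) * v η‖ ≤ 2 * ρ * M := by
  have h0 : ∫ η : ℝ, Complex.exp (Complex.I * x * η) * v η =
      ∫ η in Icc (-ρ) ρ, Complex.exp (Complex.I * x * η) * v η := by
    rw [setIntegral_eq_integral_of_forall_compl_eq_zero]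
    intro η hη
    rw [hs η, mul_zero]
    by_contra h
    exact hη (abs_le.1 (not_lt.1 h))
  rw [h0]
  refine (norm_setIntegral_le_of_norm_le_const (C := M) (by simp) fun η hη => ?_).trans ?_
  · rw [norm_mul, norm_exp_I_mul, one_mul]
    exact hM η (abs_le.2 hη)
  · simp only [Measure.real, Real.volume_Icc]
    rw [ENNReal.toReal_ofReal (by linarith)]
    linarith

theorem one_add_sq_le_two_pow (a : ℕ) : (1 + (a : ℝ)) ^ 2 ≤ 4 * 2 ^ a := by
  have h : (1 + a) ^ 2 ≤ 4 * 2 ^ a := by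
    induction a with
    | zero => norm_num
    | succ a ih =>
      rcases Nat.lt_or_ge a 2 with h | h
      · interval_cases a <;> norm_num
      · have h2 : 2 ^ (a + 1) = 2 * 2 ^ a := by ring
        rw [h2]; nlinarith
  exact_mod_cast h

section

variable {ψ : ℝ → ℝ} {ρ : ℝ}

theorem hasCompactSupport_of_abs {F : Type*} [Zero F] {v : ℝ → F}
    (hs : ∀ η, ρ < |η| → v η = 0) : HasCompactSupport v := by
  refine HasCompactSupport.intro (isCompact_Icc (a := -ρ) (b := ρ)) fun η hη => hs η ?_
  by_contra h
  exact hη (abs_le.1 (not_lt.1 h))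

theorem deriv_eq_zero_of_abs {f : ℝ → ℝ} (hs : ∀ η, ρ < |η| → f η = 0) {η : ℝ}
    (hη : ρ < |η|) : deriv f η = 0 := by
  have h : f =ᶠ[𝓝 η] fun _ => 0 := by
    filter_upwards [continuous_abs.continuousAt.eventually (lt_mem_nhds hη)] with y hy
    exact hs y hy
  rw [h.deriv_eq, deriv_const]

theorem symbol_eq_zero (hs : ∀ η, ρ < |η| → ψ η = 0) (a : ℕ) (t : ℝ) {η : ℝ} (hη : ρ < |η|) :
    symbol ψ a t η = 0 := by simp [symbol, hs η hη]

theorem continuous_symbol (hψ : Continuous ψ) (a : ℕ) (t : ℝ) : Continuous (symbol ψ a t) := by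
  unfold symbol; fun_prop

/-- Two integrations by parts give the decay in x. Each derivative falling on η^a costs a factor up
to 1 + a, and (1+a)² ≤ 4·2^a is absorbed by passing from ρ^a to (2ρ)^a; for t in [0,1] the phase
costs only powers of ρ. -/
theorem exists_kernel_bound (hψ : ContDiff ℝ ∞ ψ) (hρ : 1 ≤ ρ)
    (hs : ∀ η, ρ < |η| → ψ η = 0) :
    ∃ C : ℝ, 0 ≤ C ∧ ∀ (a : ℕ), ∀ t ∈ Icc (0 : ℝ) 1, ∀ x : ℝ,
      ‖kernel ψ a t x‖ ≤ C * (2 * ρ) ^ a / (1 + x ^ 2) := by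
  have hψ1 : ContDiff ℝ ∞ (deriv ψ) := (contDiff_infty_iff_deriv.1 hψ).2
  have hψ2 : ContDiff ℝ ∞ (deriv (deriv ψ)) := (contDiff_infty_iff_deriv.1 hψ1).2
  have hs1 : ∀ η, ρ < |η| → deriv ψ η = 0 := fun η => deriv_eq_zero_of_abs hs
  have hs2 : ∀ η, ρ < |η| → deriv (deriv ψ) η = 0 := fun η => deriv_eq_zero_of_abs hs1
  obtain ⟨K0, hK0⟩ := hψ.continuous.bounded_above_of_compact_support (hasCompactSupport_of_abs hs)
  obtain ⟨K1, hK1⟩ := hψ1.continuous.bounded_above_of_compact_support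
    (hasCompactSupport_of_abs hs1)
  obtain ⟨K2, hK2⟩ := hψ2.continuous.bounded_above_of_compact_support
    (hasCompactSupport_of_abs hs2)
  set K := max K0 (max K1 K2)
  have hK0' : ∀ η, |ψ η| ≤ K := fun η => (hK0 η).trans (le_max_left _ _)
  have hK1' : ∀ η, |deriv ψ η| ≤ K := fun η => (hK1 η).trans (by simp [K])
  have hK2' : ∀ η, |deriv (deriv ψ) η| ≤ K := fun η => (hK2 η).trans (by simp [K])
  have hK : 0 ≤ K := (abs_nonneg _).trans (hK0' 0)
  -- The second summand is the trivial bound for the kernel, the first that for x² times it. Here 11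
  -- = 1 + 2 + 4 + 4 collects the terms of `v''` once each is majorized using 1 ≤ ρ.
  refine ⟨2 * ρ * K * (4 * (11 * ρ ^ 2)) + 2 * ρ * K, by positivity, fun a t ht x => ?_⟩
  set p : ℝ → ℂ := fun η => ψ η * (η : ℂ) ^ a with hp
  -- The truncated exponents are harmless: whenever the subtraction is truncated, the coefficient in
  -- front vanishes.
  set p' : ℝ → ℂ := fun η => ((deriv ψ η : ℝ) : ℂ) * (η : ℂ) ^ a + ψ η * (a * (η : ℂ) ^ (a - 1)) with hp'
  set p'' : ℝ → ℂ := fun η => ((deriv (deriv ψ) η : ℝ) : ℂ) * (η : ℂ) ^ a +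
    ((deriv ψ η : ℝ) : ℂ) *
    (a * (η : ℂ) ^ (a - 1)) + (((deriv ψ η : ℝ) : ℂ) * (a * (η : ℂ) ^ (a - 1)) +
    ψ η * (a * ((a - 1 : ℕ) * (η : ℂ) ^ (a - 1 - 1)))) with hp''
  have dpow : ∀ (b : ℕ) (η : ℝ), HasDerivAt (fun η : ℝ => (η : ℂ) ^ b)
      (b * (η : ℂ) ^ (b - 1)) η := by
    intro b η
    have := (Complex.ofRealCLM.hasDerivAt (x := η)).pow b
    simp only [Complex.ofRealCLM_apply, Complex.ofReal_one, mul_one] at this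
    exact this
  have dψ : ∀ η, HasDerivAt (fun η => (ψ η : ℂ)) ((deriv ψ η : ℝ) : ℂ) η := fun η =>
    ((hψ.differentiable (by simp)) η).hasDerivAt.ofReal_comp
  have dψ1 : ∀ η, HasDerivAt (fun η => ((deriv ψ η : ℝ) : ℂ)) ((deriv (deriv ψ) η : ℝ) : ℂ) η := fun η =>
    ((hψ1.differentiable (by simp)) η).hasDerivAt.ofReal_comp
  have dp : ∀ η, HasDerivAt p (p' η) η := fun η => (dψ η).mul (dpow a η)
  have dp' : ∀ η, HasDerivAt p' (p'' η) η := fun η =>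
    ((dψ1 η).mul (dpow a η)).add ((dψ η).mul ((dpow (a - 1) η).const_mul (a : ℂ)))
  set e : ℝ → ℂ := fun η => Complex.exp (Complex.I * t * (η : ℂ) ^ 2) with he
  have de : ∀ η, HasDerivAt e (e η * (Complex.I * t * (2 * η))) η := by
    intro η
    have := ((dpow 2 η).const_mul (Complex.I * (t : ℂ))).cexp
    simpa using this
  set v' : ℝ → ℂ := fun η => (p' η + Complex.I * t * (2 * η) * p η) * e η with hv'
  set v'' : ℝ → ℂ := fun η => (p'' η + (Complex.I * t * 2 * p η + Complex.I * t * (2 * η) * p' η) +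
    Complex.I * t * (2 * η) * (p' η + Complex.I * t * (2 * η) * p η)) * e η with hv''
  have dv : ∀ η, HasDerivAt (symbol ψ a t) (v' η) η := by
    intro η
    convert! (dp η).mul (de η) using 1
    simp only [hv']; ring
  have dv' : ∀ η, HasDerivAt v' (v'' η) η := by
    intro η
    have hlin : HasDerivAt (fun η : ℝ => Complex.I * t * (2 * (η : ℂ))) (Complex.I * t * 2) η := by
      have := (Complex.ofRealCLM.hasDerivAt (x := η)).const_mul (Complex.I * (t : ℂ) * 2)
      simpa [mul_assoc] using this
    convert! ((dp' η).add (hlin.mul (dp η))).mul (de η) using 1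
    simp only [hv'', Pi.add_apply, Pi.mul_apply]; ring
  have c0 := hψ.continuous
  have c1 := hψ1.continuous
  have c2 := hψ2.continuous
  have hv'c : Continuous v' := by simp only [hv', hp, hp', he]; fun_prop
  have hv''c : Continuous v'' := by simp only [hv'', hp, hp', hp'', he]; fun_prop
  have sv : ∀ η, ρ < |η| → symbol ψ a t η = 0 := fun η => symbol_eq_zero hs a t
  have sv' : ∀ η, ρ < |η| → v' η = 0 := fun η h => by simp [hv', hp, hp', hs η h, hs1 η h]
  have sv'' : ∀ η, ρ < |η| → v'' η = 0 := fun η h => by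
    simp [hv'', hp, hp', hp'', hs η h, hs1 η h, hs2 η h]
  have h1 := mul_integral_exp_mul dv hv'c (hasCompactSupport_of_abs sv)
    (hasCompactSupport_of_abs sv') x
  have h2 := mul_integral_exp_mul dv' hv''c (hasCompactSupport_of_abs sv')
    (hasCompactSupport_of_abs sv'') x
  have hpow : ∀ (b : ℕ) (η : ℝ), b ≤ a → |η| ≤ ρ → |η| ^ b ≤ ρ ^ a := fun b η hb hη =>
    (pow_le_pow_left₀ (abs_nonneg _) hη b).trans (pow_le_pow_right₀ hρ hb)
  have hρ0 : 0 ≤ ρ := by linarith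
  have ha1 : ((a - 1 : ℕ) : ℝ) ≤ a := by exact_mod_cast Nat.sub_le a 1
  have bp : ∀ η, |η| ≤ ρ → ‖p η‖ ≤ K * ρ ^ a := by
    intro η hη
    simp only [hp, norm_mul, norm_pow, Complex.norm_real, Real.norm_eq_abs]
    exact mul_le_mul (hK0' η) (hpow a η le_rfl hη) (by positivity) hK
  have bp' : ∀ η, |η| ≤ ρ → ‖p' η‖ ≤ K * ρ ^ a * (1 + a) := by
    intro η hη
    refine (norm_add_le _ _).trans ?_
    simp only [norm_mul, norm_pow, Complex.norm_real, Real.norm_eq_abs, Complex.norm_natCast]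
    calc |deriv ψ η| * |η| ^ a + |ψ η| * (a * |η| ^ (a - 1))
        ≤ K * ρ ^ a + K * (a * ρ ^ a) := by
          gcongr
          · exact hK1' η
          · exact hK0' η
          · exact hpow _ _ (Nat.sub_le _ _) hη
      _ = _ := by ring
  have bp'' : ∀ η, |η| ≤ ρ → ‖p'' η‖ ≤ K * ρ ^ a * (1 + a) ^ 2 := by
    intro η hη
    refine (norm_add_le _ _).trans ((add_le_add (norm_add_le _ _) (norm_add_le _ _)).trans ?_)
    simp only [norm_mul, norm_pow, Complex.norm_real, Real.norm_eq_abs, Complex.norm_natCast]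
    calc _ ≤ (K * ρ ^ a + K * (a * ρ ^ a)) + (K * (a * ρ ^ a) + K * (a * (a * ρ ^ a))) := by
          gcongr
          · exact hK2' η
          · exact hK1' η
          · exact hpow _ _ (Nat.sub_le _ _) hη
          · exact hK1' η
          · exact hpow _ _ (Nat.sub_le _ _) hη
          · exact hK0' η
          · exact hpow _ _ ((Nat.sub_le _ _).trans (Nat.sub_le _ _)) hη
      _ = _ := by ring
  have hen : ∀ η, ‖e η‖ = 1 := fun η => norm_exp_I_mul_sq t η
  have hlin : ∀ η : ℝ, |η| ≤ ρ → ‖Complex.I * t * (2 * (η : ℂ))‖ ≤ 2 * ρ := by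
    intro η hη
    simp only [norm_mul, Complex.norm_I, one_mul, Complex.norm_real, Real.norm_eq_abs,
      Complex.norm_ofNat]
    rw [abs_of_nonneg ht.1]
    nlinarith [ht.1, ht.2, abs_nonneg η]
  have hI2 : ‖Complex.I * t * 2‖ ≤ 2 := by
    simp only [norm_mul, Complex.norm_I, one_mul, Complex.norm_real, Real.norm_eq_abs,
      Complex.norm_ofNat]
    rw [abs_of_nonneg ht.1]
    linarith [ht.2]
  have bv'' : ∀ η, |η| ≤ ρ → ‖v'' η‖ ≤ K * ρ ^ a * ((1 + a) ^ 2 * (11 * ρ ^ 2)) := by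
    intro η hη
    have q0 := bp η hη
    have q1 := bp' η hη
    have q2 := bp'' η hη
    have l := hlin η hη
    simp only [hv'', norm_mul, hen, mul_one]
    calc _ ≤ ‖p'' η‖ + (‖Complex.I * t * 2‖ * ‖p η‖ + ‖Complex.I * t * (2 * (η : ℂ))‖ * ‖p' η‖) +
          ‖Complex.I * t * (2 * (η : ℂ))‖ *
            (‖p' η‖ + ‖Complex.I * t * (2 * (η : ℂ))‖ * ‖p η‖) := by
          refine (norm_add_le _ _).trans (add_le_add ((norm_add_le _ _).trans
            (add_le_add le_rfl ((norm_add_le _ _).trans ?_))) ?_)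
          · rw [norm_mul (Complex.I * t * 2), norm_mul (Complex.I * t * (2 * (η : ℂ)))]
          · rw [norm_mul (Complex.I * t * (2 * (η : ℂ)))]
            gcongr
            refine (norm_add_le _ _).trans ?_
            rw [norm_mul (Complex.I * t * (2 * (η : ℂ)))]
      _ ≤ K * ρ ^ a * (1 + a) ^ 2 + (2 * (K * ρ ^ a) + 2 * ρ * (K * ρ ^ a * (1 + a))) +
          2 * ρ * (K * ρ ^ a * (1 + a) + 2 * ρ * (K * ρ ^ a)) := by gcongr
      _ = K * ρ ^ a * ((1 + a) ^ 2 + 2 + 4 * ρ * (1 + a) + 4 * ρ ^ 2) := by ring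
      _ ≤ _ := by
        gcongr
        have h1a : 1 ≤ 1 + (a : ℝ) := by simp
        have i1 : 1 ≤ (1 + (a : ℝ)) ^ 2 := one_le_pow₀ h1a
        have i2 : 1 + (a : ℝ) ≤ (1 + (a : ℝ)) ^ 2 := by nlinarith
        have i3 : 1 ≤ ρ ^ 2 := one_le_pow₀ hρ
        have i4 : ρ ≤ ρ ^ 2 := by nlinarith
        have i5 : ρ * (1 + (a : ℝ)) ≤ ρ ^ 2 * (1 + (a : ℝ)) ^ 2 := by gcongr
        have i6 : (1 + (a : ℝ)) ^ 2 ≤ ρ ^ 2 * (1 + (a : ℝ)) ^ 2 := le_mul_of_one_le_left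
          (by positivity) i3
        have i7 : ρ ^ 2 ≤ ρ ^ 2 * (1 + (a : ℝ)) ^ 2 := le_mul_of_one_le_right (by positivity) i1
        nlinarith
  have hker : ‖kernel ψ a t x‖ ≤ 2 * ρ * (K * ρ ^ a) :=
    norm_integral_le_of_support hρ0 sv (fun η hη => by
      have : symbol ψ a t η = p η * e η := rfl
      rw [this, norm_mul, hen, mul_one]
      exact bp η hη) x
  have hker2 : x ^ 2 * ‖kernel ψ a t x‖ ≤
      2 * ρ * (K * ρ ^ a * ((1 + a) ^ 2 * (11 * ρ ^ 2))) := by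
    have h3 : (x : ℂ) ^ 2 * kernel ψ a t x =
        -∫ η : ℝ, Complex.exp (Complex.I * x * η) * v'' η := by
      have h4 : Complex.I * x * (Complex.I * x * kernel ψ a t x) =
          ∫ η : ℝ, Complex.exp (Complex.I * x * η) * v'' η := by
        rw [kernel, h1, mul_neg, h2, neg_neg]
      rw [← h4]
      linear_combination ((x : ℂ) ^ 2 * kernel ψ a t x) * Complex.I_sq
    have h5 : x ^ 2 * ‖kernel ψ a t x‖ = ‖(x : ℂ) ^ 2 * kernel ψ a t x‖ := by
      rw [norm_mul, norm_pow, Complex.norm_real, Real.norm_eq_abs, sq_abs]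
    rw [h5, h3, norm_neg]
    exact norm_integral_le_of_support hρ0 sv'' bv'' x
  rw [le_div_iff₀ (by positivity)]
  have h2a := one_add_sq_le_two_pow a
  have h2p : (1 : ℝ) ≤ 2 ^ a := one_le_pow₀ one_le_two
  rw [mul_pow]
  calc ‖kernel ψ a t x‖ * (1 + x ^ 2) = ‖kernel ψ a t x‖ + x ^ 2 * ‖kernel ψ a t x‖ := by ring
    _ ≤ 2 * ρ * (K * ρ ^ a) * 2 ^ a +
        2 * ρ * (K * ρ ^ a * (4 * 2 ^ a * (11 * ρ ^ 2))) := by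
        refine add_le_add (hker.trans (le_mul_of_one_le_right (by positivity) h2p))
          (hker2.trans ?_)
        gcongr
    _ = _ := by ring

/-- Differentiating e^{itη²} brings down iη², which only raises the exponent by two, so Lipschitz
bounds in time reduce to the same kernel estimate. The phases are unimodular, hence the symbol at
time 0 dominates. -/
theorem hasDerivAt_kernel (hψ : Continuous ψ) (hs : ∀ η, ρ < |η| → ψ η = 0) (a : ℕ) (t x : ℝ) :
    HasDerivAt (fun t => kernel ψ a t x) (Complex.I * kernel ψ (a + 2) t x) t := by
  have hcs : ∀ b t, HasCompactSupport (symbol ψ b t) := fun b t =>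
    hasCompactSupport_of_abs fun η => symbol_eq_zero hs b t
  have h := (hasDerivAt_integral_of_dominated_loc_of_deriv_le (μ := volume) (x₀ := t)
    (s := univ) (bound := fun η => ‖symbol ψ (a + 2) 0 η‖)
    (F := fun t η => Complex.exp (Complex.I * x * η) * symbol ψ a t η)
    (F' := fun t η => Complex.exp (Complex.I * x * η) * (Complex.I * symbol ψ (a + 2) t η))
    univ_mem ?_ ?_ ?_ ?_ ?_ ?_).2
  · convert! h using 1
    rw [kernel, ← integral_const_mul]
    exact integral_congr_ae (Eventually.of_forall fun η => by ring)
  · exact Eventually.of_forall fun s =>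
      (integrable_exp_mul (continuous_symbol hψ a s) (hcs a s) x).1
  · exact integrable_exp_mul (continuous_symbol hψ a t) (hcs a t) x
  · have := continuous_symbol hψ (a + 2) t
    exact Continuous.aestronglyMeasurable (by fun_prop)
  · refine Eventually.of_forall fun η s _ => ?_
    rw [norm_mul, norm_exp_I_mul, one_mul, norm_mul, Complex.norm_I, one_mul, symbol, symbol,
      norm_mul, norm_mul _ (Complex.exp _), norm_exp_I_mul_sq, norm_exp_I_mul_sq]
  · exact ((continuous_symbol hψ _ _).integrable_of_hasCompactSupport (hcs _ _)).norm
  · refine Eventually.of_forall fun η s _ => HasDerivAt.const_mul _ ?_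
    have h1 : HasDerivAt (fun s : ℝ => Complex.I * s * (η : ℂ) ^ 2) (Complex.I * (η : ℂ) ^ 2) s := by
      have := ((Complex.ofRealCLM.hasDerivAt (x := s)).const_mul Complex.I).mul_const ((η : ℂ) ^ 2)
      simpa using this
    convert! h1.cexp.const_mul (ψ η * (η : ℂ) ^ a) using 1
    simp only [symbol]
    ring

end

end

/-! ### Test vectors extracting Taylor coefficients. -/

section

variable {n : ℕ}

/-- The symbol on `ℝⁿ`, in the frequency variable of Mathlib, whose inverse Fourier transform is paired
with the evolution in order to extract a Taylor coefficient at a lattice point. -/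
def testSymbol (ψ : ℝ → ℝ) (α : Fin n → ℕ) (l : Fin n → ℤ) (ξ₀ : E n) (t : ℝ) (ζ : E n) : ℂ :=
  ∏ i, (starRingEnd ℂ) (Complex.exp (Complex.I * (l i : ℝ) * ((2 * Real.pi * ζ i - ξ₀ i : ℝ) : ℂ)) *
    symbol ψ (α i) t (2 * Real.pi * ζ i - ξ₀ i))

/-- The vector of `L²` with Fourier transform `testSymbol`. -/
def testVec (ψ : ℝ → ℝ) (α : Fin n → ℕ) (l : Fin n → ℤ) (ξ₀ : E n) (t : ℝ) : L2 n :=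
  𝓕⁻ (toL2 (testSymbol ψ α l ξ₀ t))

/-- The characteristic function of the ball of radius `r` about a lattice point. -/
def cell (r : ℝ) (k : Fin n → ℤ) : E n → ℂ :=
  (Metric.closedBall (latticePt k) r).indicator fun _ => 1

/-- The weight `∏ (1 + mᵢ²)⁻¹` on the lattice. -/
def weight (m : Fin n → ℤ) : ℝ := ∏ i, (1 + (m i : ℝ) ^ 2)⁻¹

theorem weight_nonneg (m : Fin n → ℤ) : 0 ≤ weight m :=
  Finset.prod_nonneg fun _ _ => by positivity

theorem coord_freq (ζ ξ₀ : E n) (i : Fin n) :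
    ((2 * Real.pi) • ζ - ξ₀) i = 2 * Real.pi * ζ i - ξ₀ i := by simp

/-- The one-dimensional phases multiply to a single quadratic phase in ξ - ξ₀, bounded on the
support of the symbol. This is the form needed for smoothness of the test vector in time. -/
theorem testSymbol_eq (ψ : ℝ → ℝ) (α : Fin n → ℕ) (l : Fin n → ℤ) (ξ₀ : E n) (t : ℝ) (ζ : E n) :
    testSymbol ψ α l ξ₀ t ζ = testSymbol ψ α l ξ₀ 0 ζ *
      Complex.exp (-(Complex.I * t * (‖(2 * Real.pi) • ζ - ξ₀‖ ^ 2 : ℝ))) := by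
  rw [EuclideanSpace.real_norm_sq_eq, Complex.ofReal_sum, Finset.mul_sum, ← Finset.sum_neg_distrib,
    Complex.exp_sum, testSymbol, testSymbol, ← Finset.prod_mul_distrib]
  refine Finset.prod_congr rfl fun i _ => ?_
  simp only [coord_freq, symbol, map_mul, ← Complex.exp_conj, Complex.conj_I, Complex.conj_ofReal,
    map_pow]
  simp only [Complex.ofReal_zero, mul_zero, zero_mul, Complex.exp_zero, mul_one]
  push_cast
  rw [neg_mul, neg_mul]
  ring_nf

section

variable {ψ : ℝ → ℝ} {ρ : ℝ}

theorem continuous_testSymbol (hψ : Continuous ψ) (α : Fin n → ℕ) (l : Fin n → ℤ) (ξ₀ : E n)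
    (t : ℝ) : Continuous (testSymbol ψ α l ξ₀ t) := by
  unfold testSymbol symbol
  refine continuous_finsetProd _ fun i _ => Complex.continuous_conj.comp ?_
  fun_prop

theorem norm_sq_le_of_testSymbol_ne_zero (hs : ∀ η, ρ < |η| → ψ η = 0) {α : Fin n → ℕ}
    {l : Fin n → ℤ} {ξ₀ : E n} {t : ℝ} {ζ : E n} (h : testSymbol ψ α l ξ₀ t ζ ≠ 0) :
    ‖(2 * Real.pi) • ζ - ξ₀‖ ^ 2 ≤ n * ρ ^ 2 := by
  rw [EuclideanSpace.real_norm_sq_eq]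
  calc _ ≤ ∑ _i : Fin n, ρ ^ 2 := by
        refine Finset.sum_le_sum fun i _ => ?_
        rw [coord_freq]
        have h1 := Finset.prod_ne_zero_iff.1 h i (Finset.mem_univ i)
        rw [map_ne_zero] at h1
        have h2 : ¬ ρ < |2 * Real.pi * ζ i - ξ₀ i| := fun hlt =>
          right_ne_zero_of_mul h1 (symbol_eq_zero hs _ _ hlt)
        exact sq_le_sq' (abs_le.1 (not_lt.1 h2)).1 (abs_le.1 (not_lt.1 h2)).2
    _ = n * ρ ^ 2 := by simp

theorem hasCompactSupport_testSymbol (hs : ∀ η, ρ < |η| → ψ η = 0) (α : Fin n → ℕ)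
    (l : Fin n → ℤ) (ξ₀ : E n) (t : ℝ) : HasCompactSupport (testSymbol ψ α l ξ₀ t) := by
  refine HasCompactSupport.intro (isCompact_closedBall (0 : E n)
    ((Real.sqrt (n * ρ ^ 2) + ‖ξ₀‖) / (2 * Real.pi))) fun ζ hζ => ?_
  by_contra h
  refine hζ ?_
  have h1 := Real.le_sqrt_of_sq_le (norm_sq_le_of_testSymbol_ne_zero hs h)
  rw [mem_closedBall_zero_iff, le_div_iff₀ (by positivity)]
  have h2 : ‖(2 * Real.pi) • ζ‖ ≤ ‖(2 * Real.pi) • ζ - ξ₀‖ + ‖ξ₀‖ := by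
    simpa using norm_add_le ((2 * Real.pi) • ζ - ξ₀) ξ₀
  rw [norm_smul, Real.norm_eq_abs, abs_of_pos (by positivity)] at h2
  linarith

theorem memLp_testSymbol (hψ : Continuous ψ) (hs : ∀ η, ρ < |η| → ψ η = 0) (α : Fin n → ℕ)
    (l : Fin n → ℤ) (ξ₀ : E n) (t : ℝ) : MemLp (testSymbol ψ α l ξ₀ t) 2 volume :=
  (continuous_testSymbol hψ α l ξ₀ t).memLp_of_hasCompactSupport
    (hasCompactSupport_testSymbol hs α l ξ₀ t)

theorem contDiff_testVec (hψ : Continuous ψ) (hs : ∀ η, ρ < |η| → ψ η = 0) (α : Fin n → ℕ)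
    (l : Fin n → ℤ) (ξ₀ : E n) : ContDiff ℝ ∞ (testVec ψ α l ξ₀) := by
  have h := contDiff_toL2_mul_exp (s := fun ζ : E n => ‖(2 * Real.pi) • ζ - ξ₀‖ ^ 2)
    (B := n * ρ ^ 2) (by fun_prop) (memLp_testSymbol hψ hs α l ξ₀ 0) (fun ζ hζ => by
      rw [abs_of_nonneg (by positivity)]
      exact norm_sq_le_of_testSymbol_ne_zero hs hζ)
  simp_rw [← testSymbol_eq] at h
  exact ((Lp.fourierTransformₗᵢ (E n) ℂ).symm.toContinuousLinearEquiv.toContinuousLinearMap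
    |>.restrictScalars ℝ).contDiff.comp h

/-- The substitution η = 2πζ - ξ₀ turns the integral into a modulation times a product of
one-dimensional integrals, with Jacobian (2π)^{-n}. The frequency ξ₀ survives only in a unimodular
factor, which makes all later bounds uniform in ξ₀. -/
theorem fourierInv_testSymbol (ψ : ℝ → ℝ) (α : Fin n → ℕ) (l : Fin n → ℤ) (ξ₀ : E n) (t : ℝ)
    (x : E n) : 𝓕⁻ (testSymbol ψ α l ξ₀ t) x =
      Complex.exp (Complex.I * (inner ℝ x ξ₀ : ℝ)) * (((2 * Real.pi) ^ n)⁻¹ : ℝ) *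
        ∏ i, (starRingEnd ℂ) (kernel ψ (α i) t (l i - x i)) := by
  rw [Real.fourierInv_eq']
  set F : E n → ℂ := fun η => ∏ i, (starRingEnd ℂ)
    (Complex.exp (Complex.I * ((l i - x i : ℝ) : ℂ) * (η i : ℂ)) * symbol ψ (α i) t (η i)) with hF
  have h1 : ∀ ζ : E n, Complex.exp (((2 * Real.pi * inner ℝ ζ x : ℝ) : ℂ) * Complex.I) •
      testSymbol ψ α l ξ₀ t ζ =
      Complex.exp (Complex.I * (inner ℝ x ξ₀ : ℝ)) * F ((2 * Real.pi) • ζ - ξ₀) := by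
    intro ζ
    have e1 : ((2 * Real.pi * inner ℝ ζ x : ℝ) : ℂ) * Complex.I =
        Complex.I * (inner ℝ x ξ₀ : ℝ) +
          ∑ i, Complex.I * (x i : ℂ) * (2 * Real.pi * ζ i - ξ₀ i : ℝ) := by
      rw [PiLp.inner_apply, PiLp.inner_apply]
      simp only [RCLike.inner_apply, conj_trivial]
      push_cast
      rw [Finset.mul_sum, Finset.mul_sum, Finset.sum_mul, ← Finset.sum_add_distrib]
      exact Finset.sum_congr rfl fun i _ => by ring
    rw [e1, Complex.exp_add, Complex.exp_sum, smul_eq_mul, mul_assoc, testSymbol, hF,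
      ← Finset.prod_mul_distrib]
    congr 1
    refine Finset.prod_congr rfl fun i _ => ?_
    rw [coord_freq, map_mul, map_mul, ← mul_assoc, ← Complex.exp_conj, ← Complex.exp_conj,
      ← Complex.exp_add]
    congr 2
    simp only [map_mul, Complex.conj_I, Complex.conj_ofReal]
    push_cast
    ring
  simp_rw [h1]
  rw [integral_const_mul, mul_assoc]
  congr 1
  have h2 := Measure.integral_comp_smul (volume : Measure (E n)) (fun η => F (η - ξ₀))
    (2 * Real.pi)
  rw [h2, integral_sub_right_eq_self F ξ₀, finrank_euclideanSpace_fin, abs_of_pos (by positivity),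
    Complex.real_smul]
  congr 1
  rw [← (EuclideanSpace.volume_preserving_symm_measurableEquiv_toLp (Fin n)).symm.integral_comp
    (MeasurableEquiv.measurableEmbedding _)]
  have h3 := integral_fintype_prod_volume_eq_prod (𝕜 := ℂ) (fun (i : Fin n) (y : ℝ) =>
    (starRingEnd ℂ) (Complex.exp (Complex.I * ((l i - x i : ℝ) : ℂ) * (y : ℂ)) *
      symbol ψ (α i) t y))
  convert! h3 using 1
  refine Finset.prod_congr rfl fun i _ => ?_
  rw [integral_conj, kernel]

theorem testVec_ae_eq (hψ : Continuous ψ) (hs : ∀ η, ρ < |η| → ψ η = 0) (α : Fin n → ℕ)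
    (l : Fin n → ℤ) (ξ₀ : E n) (t : ℝ) : testVec ψ α l ξ₀ t =ᵐ[volume] fun x =>
      Complex.exp (Complex.I * (inner ℝ x ξ₀ : ℝ)) * (((2 * Real.pi) ^ n)⁻¹ : ℝ) *
        ∏ i, (starRingEnd ℂ) (kernel ψ (α i) t (l i - x i)) := by
  have h0 := toL2_coe (memLp_testSymbol hψ hs α l ξ₀ t)
  have hint : Integrable (testSymbol ψ α l ξ₀ t) :=
    (continuous_testSymbol hψ α l ξ₀ t).integrable_of_hasCompactSupport
    (hasCompactSupport_testSymbol hs α l ξ₀ t)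
  have h1 := fourierInv_ae_eq (toL2 (testSymbol ψ α l ξ₀ t)) (hint.congr h0.symm)
  filter_upwards [h1] with x hx
  rw [testVec, hx, ← fourierInv_testSymbol, Real.fourierInv_eq', Real.fourierInv_eq']
  refine integral_congr_ae ?_
  filter_upwards [h0] with ζ hζ
  rw [hζ]

/-- This transfers decay from a point of a cell to the lattice point at its centre. -/
theorem one_add_sq_inv_le {r d e : ℝ} (he : |e| ≤ r) :
    (1 + (d - e) ^ 2)⁻¹ ≤ 2 * (1 + r ^ 2) * (1 + d ^ 2)⁻¹ := by
  rw [← div_eq_mul_inv, inv_eq_one_div, div_le_div_iff₀ (by positivity) (by positivity)]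
  have h1 : e ^ 2 ≤ r ^ 2 := sq_le_sq' (abs_le.1 he).1 (abs_le.1 he).2
  nlinarith [sq_nonneg (d - 2 * e), sq_nonneg (d - e), mul_nonneg (sq_nonneg r) (sq_nonneg (d - e))]

theorem norm_mulL2_cell_le {r : ℝ} (k : Fin n → ℤ) {f : L2 n} {c : ℝ}
    (hf : ∀ᵐ x, x ∈ Metric.closedBall (latticePt k) r → ‖f x‖ ≤ c) :
    ‖mulL2 (cell r k) f‖ ≤ c * (volume (Metric.closedBall (0 : E n) r)).toReal ^ (1 / 2 : ℝ) := by
  have hm : MeasurableSet (Metric.closedBall (latticePt k : E n) r) :=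
    Metric.isClosed_closedBall.measurableSet
  have hfin : volume (Metric.closedBall (latticePt k : E n) r) ≠ ⊤ :=
    (isCompact_closedBall _ _).measure_lt_top.ne
  have h : ‖mulL2 (cell r k) f‖ ≤ c * ‖indicatorConstLp 2 hm hfin (1 : ℂ)‖ := by
    refine Lp.norm_le_mul_norm_of_ae_le_mul ?_
    filter_upwards [hf, indicatorConstLp_coeFn (p := 2) (hs := hm) (hμs := hfin) (c := (1 : ℂ)),
      mulL2_coe (m := cell r k) (B := 1) ((stronglyMeasurable_const.indicator hm).aestronglyMeasurable)
      (fun x => by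
        unfold cell
        by_cases hx : x ∈ Metric.closedBall (latticePt k) r <;> simp [hx]) f] with x h1 h2 h3
    rw [h2, h3, cell]
    by_cases hx : x ∈ Metric.closedBall (latticePt k) r
    · simpa [hx] using h1 hx
    · simp [hx]
  rw [norm_indicatorConstLp (by norm_num) (by norm_num), norm_one, one_mul, Measure.real,
    Measure.addHaar_closedBall_center] at h
  exact h

theorem exists_clm_cell (r : ℝ) (k : Fin n → ℤ) :
    ∃ T : L2 n →L[ℂ] L2 n, ∀ f, T f = mulL2 (cell r k) f := by
  refine exists_clm_mulL2 (B := 1) ((stronglyMeasurable_const.indicator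
    Metric.isClosed_closedBall.measurableSet).aestronglyMeasurable) fun x => ?_
  unfold cell
  by_cases hx : x ∈ Metric.closedBall (latticePt k) r <;> simp [hx]

theorem norm_exp_inner_mul (x ξ₀ : E n) :
    ‖Complex.exp (Complex.I * (inner ℝ x ξ₀ : ℝ)) * (((2 * Real.pi) ^ n)⁻¹ : ℝ)‖ ≤ 1 := by
  rw [norm_mul, Complex.norm_exp, Complex.norm_real, Real.norm_eq_abs,
    abs_of_pos (by positivity)]
  simp only [Complex.mul_re, Complex.I_re, Complex.ofReal_re, Complex.I_im, Complex.ofReal_im,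
    zero_mul, mul_zero, sub_zero, Real.exp_zero, one_mul]
  exact inv_le_one_of_one_le₀ (one_le_pow₀ (by linarith [Real.pi_gt_three]))

/-- A pointwise bound on a ball of fixed volume is an L² bound there. For the time increments, the
product rule gives n terms, each with one exponent raised by two, and the mean value inequality
finishes. -/
theorem exists_norm_cell_testVec_le (hψ : ContDiff ℝ ∞ ψ) (hρ : 1 ≤ ρ)
    (hs : ∀ η, ρ < |η| → ψ η = 0) (r : ℝ) :
    ∃ K : ℝ, 0 ≤ K ∧ ∀ (α : Fin n → ℕ) (l k : Fin n → ℤ) (ξ₀ : E n),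
      (∀ t ∈ Icc (0 : ℝ) 1, ‖mulL2 (cell r k) (testVec ψ α l ξ₀ t)‖ ≤
        K * (2 * ρ) ^ (∑ i, α i) * weight (l - k)) ∧
      ∀ t ∈ Icc (0 : ℝ) 1, ∀ s ∈ Icc (0 : ℝ) 1,
        ‖mulL2 (cell r k) (testVec ψ α l ξ₀ t) - mulL2 (cell r k) (testVec ψ α l ξ₀ s)‖ ≤
        K * (2 * ρ) ^ (∑ i, α i) * weight (l - k) * |t - s| := by
  obtain ⟨C, hC, hker⟩ := exists_kernel_bound hψ hρ hs
  have hρ1 : 1 ≤ 2 * ρ := by linarith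
  have hρ0 : 0 < 2 * ρ := by linarith
  set V := (volume (Metric.closedBall (0 : E n) r)).toReal ^ (1 / 2 : ℝ) with hV
  have hV0 : 0 ≤ V := by positivity
  -- The factor (2ρ)² leaves room for the exponent α i + 2 of a time derivative; the last factor is
  -- the cost of recentring at the lattice point.
  set D := C * (2 * ρ) ^ 2 * (2 * (1 + r ^ 2)) with hD
  have hD0 : 0 ≤ D := by positivity
  have hcoord : ∀ (α : Fin n → ℕ) (l k : Fin n → ℤ) (x : E n),
      x ∈ Metric.closedBall (latticePt k) r → ∀ t ∈ Icc (0 : ℝ) 1, ∀ (i : Fin n) (b : ℕ), b ≤ 2 →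
      ‖kernel ψ (α i + b) t (l i - x i)‖ ≤
        D * (2 * ρ) ^ (α i) * (1 + ((l - k) i : ℝ) ^ 2)⁻¹ := by
    intro α l k x hx t ht i b hb
    have he : |x i - k i| ≤ r := by
      have h1 : ‖(x - latticePt k) i‖ ≤ ‖x - latticePt k‖ := PiLp.norm_apply_le _ _
      rw [mem_closedBall_iff_norm] at hx
      simpa [latticePt] using h1.trans hx
    have h2 := one_add_sq_inv_le (d := ((l - k) i : ℤ)) he
    have h3 : (((l - k) i : ℤ) : ℝ) - (x i - k i) = l i - x i := by
      simp only [Pi.sub_apply]; push_cast; ring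
    rw [h3] at h2
    calc ‖kernel ψ (α i + b) t (l i - x i)‖
        ≤ C * (2 * ρ) ^ (α i + b) / (1 + (l i - x i) ^ 2) := hker _ t ht _
      _ = C * ((2 * ρ) ^ (α i) * (2 * ρ) ^ b) * (1 + (l i - x i) ^ 2)⁻¹ := by
          rw [pow_add, div_eq_mul_inv]
      _ ≤ C * ((2 * ρ) ^ (α i) * (2 * ρ) ^ 2) *
          (2 * (1 + r ^ 2) * (1 + (((l - k) i : ℤ) : ℝ) ^ 2)⁻¹) := by gcongr
      _ = _ := by rw [hD]; ring
  have hprod : ∀ (α : Fin n → ℕ) (l k : Fin n → ℤ),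
      ∏ i, D * (2 * ρ) ^ (α i) * (1 + ((l - k) i : ℝ) ^ 2)⁻¹ =
        D ^ n * (2 * ρ) ^ (∑ i, α i) * weight (l - k) := by
    intro α l k
    rw [Finset.prod_mul_distrib, Finset.prod_mul_distrib, Finset.prod_pow_eq_pow_sum, weight]
    simp
  -- The size bound needs the factor 1 and the Lipschitz bound the factor n; n + 1 serves both.
  refine ⟨(n + 1) * D ^ n * V, by positivity, fun α l k ξ₀ => ⟨fun t ht => ?_, fun t ht s hs' => ?_⟩⟩
  · have h : ∀ᵐ x, x ∈ Metric.closedBall (latticePt k) r → ‖testVec ψ α l ξ₀ t x‖ ≤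
        D ^ n * (2 * ρ) ^ (∑ i, α i) * weight (l - k) := by
      filter_upwards [testVec_ae_eq hψ.continuous hs α l ξ₀ t] with x hx hxk
      rw [hx, norm_mul, norm_prod, ← hprod]
      refine (mul_le_of_le_one_left (Finset.prod_nonneg fun _ _ => norm_nonneg _)
        (norm_exp_inner_mul x ξ₀)).trans (Finset.prod_le_prod (fun _ _ => norm_nonneg _) fun i _ => ?_)
      rw [RCLike.norm_conj]
      exact hcoord α l k x hxk t ht i 0 (by norm_num)
    refine (norm_mulL2_cell_le k h).trans ?_
    have hw := weight_nonneg (l - k)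
    have : 0 ≤ (n : ℝ) * (D ^ n * V * (2 * ρ) ^ (∑ i, α i) * weight (l - k)) := by positivity
    nlinarith
  · obtain ⟨T, hT⟩ := exists_clm_cell (n := n) r k
    rw [← hT, ← hT, ← map_sub, hT]
    have h : ∀ᵐ x, x ∈ Metric.closedBall (latticePt k) r →
        ‖(testVec ψ α l ξ₀ t - testVec ψ α l ξ₀ s : L2 n) x‖ ≤
        n * (D ^ n * (2 * ρ) ^ (∑ i, α i) * weight (l - k)) * |t - s| := by
      filter_upwards [testVec_ae_eq hψ.continuous hs α l ξ₀ t,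
        testVec_ae_eq hψ.continuous hs α l ξ₀ s,
        Lp.coeFn_sub (testVec ψ α l ξ₀ t) (testVec ψ α l ξ₀ s)] with x hx hx' hd hxk
      rw [hd, Pi.sub_apply, hx, hx', ← mul_sub, norm_mul]
      refine (mul_le_of_le_one_left (norm_nonneg _) (norm_exp_inner_mul x ξ₀)).trans ?_
      rw [← map_prod, ← map_prod, ← map_sub, RCLike.norm_conj]
      have hder : ∀ τ ∈ Icc (0 : ℝ) 1, HasDerivWithinAt
          (fun τ => ∏ i, kernel ψ (α i) τ (l i - x i))
          (∑ i, (∏ j ∈ Finset.univ.erase i, kernel ψ (α j) τ (l j - x j)) •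
            (Complex.I * kernel ψ (α i + 2) τ (l i - x i))) (Icc 0 1) τ := fun τ _ =>
        (HasDerivAt.fun_finsetProd fun i _ =>
          hasDerivAt_kernel hψ.continuous hs (α i) τ (l i - x i)).hasDerivWithinAt
      have hbd : ∀ τ ∈ Icc (0 : ℝ) 1,
          ‖∑ i, (∏ j ∈ Finset.univ.erase i, kernel ψ (α j) τ (l j - x j)) •
            (Complex.I * kernel ψ (α i + 2) τ (l i - x i))‖ ≤
          n * (D ^ n * (2 * ρ) ^ (∑ i, α i) * weight (l - k)) := by
        intro τ hτ
        refine (norm_sum_le _ _).trans ?_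
        calc _ ≤ ∑ _i : Fin n, D ^ n * (2 * ρ) ^ (∑ i, α i) * weight (l - k) := by
              refine Finset.sum_le_sum fun i _ => ?_
              rw [← hprod, ← Finset.prod_erase_mul _ _ (Finset.mem_univ i), norm_smul, norm_prod,
                norm_mul, Complex.norm_I, one_mul]
              refine mul_le_mul (Finset.prod_le_prod (fun _ _ => norm_nonneg _) fun j _ => ?_)
                (hcoord α l k x hxk τ hτ i 2 le_rfl) (norm_nonneg _)
                (Finset.prod_nonneg fun _ _ => by positivity)
              exact hcoord α l k x hxk τ hτ j 0 (by norm_num)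
          _ = _ := by simp
      have := (convex_Icc (0 : ℝ) 1).norm_image_sub_le_of_norm_hasDerivWithin_le hder hbd hs' ht
      rwa [Real.norm_eq_abs] at this
    refine (norm_mulL2_cell_le k h).trans ?_
    have hw := weight_nonneg (l - k)
    have : 0 ≤ D ^ n * V * (2 * ρ) ^ (∑ i, α i) * weight (l - k) * |t - s| := by positivity
    nlinarith

end

end

/-! ### Lattice sums and V² bounds for the Taylor coefficients. -/

section

theorem hasSum_prod_pi {κ 𝕜 : Type*} [NormedCommRing 𝕜] [CompleteSpace 𝕜] {n : ℕ}
    {f : Fin n → κ → 𝕜} {s : Fin n → 𝕜} (hs : ∀ i, HasSum (f i) (s i))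
    (hn : ∀ i, Summable fun m => ‖f i m‖) :
    HasSum (fun m : Fin n → κ => ∏ i, f i (m i)) (∏ i, s i) ∧
      Summable fun m : Fin n → κ => ‖∏ i, f i (m i)‖ := by
  induction n with
  | zero =>
    constructor
    · simp [hasSum_unique]
    · exact (hasSum_unique _).summable
  | succ n ih =>
    obtain ⟨h1, h2⟩ := ih (fun i => hs i.succ) (fun i => hn i.succ)
    have h3 := Summable.mul_norm (hn 0) h2
    have h4 := (hs 0).mul h1 h3.of_norm
    rw [← (Fin.consEquiv fun _ => κ).hasSum_iff, ← (Fin.consEquiv fun _ => κ).summable_iff,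
      Fin.prod_univ_succ]
    constructor
    · convert! h4 using 2 with p
      simp [Fin.prod_univ_succ, Fin.consEquiv]
    · refine (summable_congr ?_).1 h3
      intro p
      simp [Fin.prod_univ_succ, Fin.consEquiv]

theorem summable_int_one_add_sq_inv : Summable fun m : ℤ => (1 + (m : ℝ) ^ 2)⁻¹ := by
  have h1 : Summable fun m : ℤ => 1 / (m : ℝ) ^ 2 := Real.summable_one_div_int_pow.2 one_lt_two
  have h2 : Summable fun m : ℤ => if m = 0 then (1 : ℝ) else 0 := (hasSum_ite_eq 0 1).summable
  refine Summable.of_nonneg_of_le (fun m => by positivity) (fun m => ?_) (h1.add h2)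
  by_cases hm : m = 0
  · simp [hm]
  · have : 0 < (m : ℝ) ^ 2 := by positivity
    simp only [hm, if_false, add_zero, one_div]
    gcongr
    linarith

variable {n : ℕ}

theorem summable_weight : Summable (weight : (Fin n → ℤ) → ℝ) :=
  (hasSum_prod_pi (fun _ => summable_int_one_add_sq_inv.hasSum)
    fun _ => summable_int_one_add_sq_inv.norm).1.summable

theorem integral_norm_inner_le (f g : L2 n) : ∫ x, ‖inner ℂ (f x) (g x)‖ ≤ ‖f‖ * ‖g‖ := by
  have h1 : ∀ x, inner ℂ (f x) (g x) = ((fun x => (starRingEnd ℂ) (f x)) • (g : E n → ℂ)) x := by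
    intro x
    simp [RCLike.inner_apply, mul_comm]
  have hf : AEStronglyMeasurable (fun x => (starRingEnd ℂ) (f x)) volume :=
    Complex.continuous_conj.comp_aestronglyMeasurable (Lp.aestronglyMeasurable f)
  have h2 := eLpNorm_smul_le_mul_eLpNorm (p := 2) (q := 2) (r := 1) (Lp.aestronglyMeasurable g) hf
  have h3 : eLpNorm (fun x => (starRingEnd ℂ) (f x)) 2 volume = eLpNorm f 2 volume :=
    eLpNorm_congr_norm_ae (Eventually.of_forall fun x => by simp)
  rw [integral_norm_eq_lintegral_enorm (L2.integrable_inner f g).1, Lp.norm_def, Lp.norm_def,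
    ← ENNReal.toReal_mul]
  refine ENNReal.toReal_mono (ENNReal.mul_ne_top (Lp.eLpNorm_ne_top f) (Lp.eLpNorm_ne_top g)) ?_
  rw [h3, eLpNorm_one_eq_lintegral_enorm] at h2
  simpa only [h1] using h2

section

variable {φ : E n → ℝ} {r : ℝ}

theorem mulL2_translate_coe {B : ℝ} (hφc : Continuous φ) (hB : ∀ x, |φ x| ≤ B) (k : Fin n → ℤ)
    (w : L2 n) : mulL2 (fun x => (φ (x - latticePt k) : ℂ)) w =ᵐ[volume]
      fun x => (φ (x - latticePt k) : ℂ) * w x :=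
  mulL2_coe (B := B) (Continuous.aestronglyMeasurable (by fun_prop)) (fun x => by
    simpa using hB (x - latticePt k)) w

theorem cell_coe (k : Fin n → ℤ) (w : L2 n) :
    mulL2 (cell r k) w =ᵐ[volume] fun x => cell r k x * w x :=
  mulL2_coe (m := cell r k) (B := 1) ((stronglyMeasurable_const.indicator
    Metric.isClosed_closedBall.measurableSet).aestronglyMeasurable) (fun x => by
    unfold cell
    by_cases hx : x ∈ Metric.closedBall (latticePt k) r <;> simp [hx]) w

/-- The ball about k contains the support of φ_k, so cutting `g` there changes nothing in the k-th
pairing, and the φ_k sum to one. The summability hypothesis allows termwise integration. -/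
theorem hasSum_inner_cell (hφ : IsLatticePartition φ) (hr : ∀ x, r < ‖x‖ → φ x = 0)
    (g w : L2 n) (hsum : Summable fun k => ‖mulL2 (cell r k) g‖ *
      ‖mulL2 (fun x => (φ (x - latticePt k) : ℂ)) w‖) :
    HasSum (fun k => inner ℂ (mulL2 (cell r k) g) (mulL2 (fun x => (φ (x - latticePt k) : ℂ)) w))
      (inner ℂ g w) := by
  obtain ⟨B, hB⟩ := hφ.contDiff.continuous.bounded_above_of_compact_support hφ.hasCompactSupport
  have h := hasSum_integral_of_summable_integral_norm (μ := (volume : Measure (E n)))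
    (F := fun (k : Fin n → ℤ) x => inner ℂ (mulL2 (cell r k) g x)
      (mulL2 (fun x => (φ (x - latticePt k) : ℂ)) w x))
    (fun k => L2.integrable_inner _ _)
    (Summable.of_nonneg_of_le (fun k => by positivity) (fun k => integral_norm_inner_le _ _) hsum)
  simp only [L2.inner_def]
  convert! h using 1
  refine integral_congr_ae ?_
  have h1 : ∀ᵐ x, ∀ k, mulL2 (cell r k) g x = cell r k x * g x :=
    ae_all_iff.2 fun k => cell_coe k g
  have h2 : ∀ᵐ x, ∀ k, mulL2 (fun x => (φ (x - latticePt k) : ℂ)) w x =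
      (φ (x - latticePt k) : ℂ) * w x :=
    ae_all_iff.2 fun k => mulL2_translate_coe hφ.contDiff.continuous hB k w
  filter_upwards [h1, h2] with x h1 h2
  have h3 : ∀ k, inner ℂ (mulL2 (cell r k) g x) (mulL2 (fun x => (φ (x - latticePt k) : ℂ)) w x) =
      (φ (x - latticePt k) : ℂ) * inner ℂ (g x) (w x) := by
    intro k
    rw [h1, h2, cell]
    by_cases hx : x ∈ Metric.closedBall (latticePt k) r
    · simp [hx]; ring
    · have : φ (x - latticePt k) = 0 := hr _ (by
        rw [mem_closedBall_iff_norm] at hx; exact not_le.1 hx)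
      simp [hx, this]
  simp_rw [h3]
  rw [tsum_mul_right, ← Complex.ofReal_tsum, (hφ.hasSum_one x).tsum_eq, Complex.ofReal_one, one_mul]

/-- The Taylor coefficient of order `α` at the lattice point `l` of the demodulated solution. -/
def taylorCoeff (ψ : ℝ → ℝ) (α : Fin n → ℕ) (l : Fin n → ℤ) (ξ₀ : E n) (u : ℝ → L2 n) (t : ℝ) :
    ℂ :=
  Complex.I ^ (∑ i, α i) / (∏ i, ((α i).factorial : ℂ)) *
    inner ℂ (testVec ψ α l ξ₀ t) (schrodinger t (u t))

/-- Schur's test: the coefficients of the V² estimate form a convolution matrix in l - k whose row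
and column sums all equal A = KDW. One factor A comes from the V² bound for a single l, the other
from summing over l. -/
theorem exists_taylorCoeff_bound (hφ : IsLatticePartition φ) {ψ : ℝ → ℝ} {ρ : ℝ}
    (hψ : ContDiff ℝ ∞ ψ) (hρ : 1 ≤ ρ) (hs : ∀ η, ρ < |η| → ψ η = 0) :
    ∃ K : ℝ, 0 ≤ K ∧ ∀ (ξ₀ : E n) (u : ℝ → L2 n), MemX φ u → ∀ α : Fin n → ℕ,
      (∀ l, MemV2 (taylorCoeff ψ α l ξ₀ u)) ∧
      (MemXClosure φ u → ∀ l, MemV2Closure (taylorCoeff ψ α l ξ₀ u)) ∧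
      ∑' l, v2NormSq (taylorCoeff ψ α l ξ₀ u) ≤
        ENNReal.ofReal (K * ((2 * ρ) ^ (∑ i, α i) / ∏ i, ((α i).factorial : ℝ)) ^ 2) *
          xNormSq φ u := by
  obtain ⟨r, hr⟩ := hφ.hasCompactSupport.isCompact.isBounded.subset_closedBall (0 : E n)
  have hr' : ∀ x, r < ‖x‖ → φ x = 0 := by
    intro x hx
    by_contra h
    have := hr (subset_tsupport φ h)
    rw [mem_closedBall_zero_iff] at this
    linarith
  obtain ⟨K, hK, hb⟩ := exists_norm_cell_testVec_le (n := n) hψ hρ hs r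
  set W : ℝ := ∑' m : Fin n → ℤ, weight m with hW
  have hW0 : 0 ≤ W := tsum_nonneg weight_nonneg
  refine ⟨3 * (K * W) ^ 2, by positivity, fun ξ₀ u hu α => ?_⟩
  set D : ℝ := (2 * ρ) ^ (∑ i, α i) / ∏ i, ((α i).factorial : ℝ) with hD
  have hD0 : 0 ≤ D := by positivity
  set q : ℂ := Complex.I ^ (∑ i, α i) / ∏ i, ((α i).factorial : ℂ) with hq
  have hqn : ‖q‖ = (∏ i, ((α i).factorial : ℝ))⁻¹ := by
    rw [hq, norm_div, norm_pow, Complex.norm_I, one_pow, norm_prod, one_div]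
    simp
  set c : (Fin n → ℤ) → (Fin n → ℤ) → ℝ≥0 := fun l k =>
    (K * D * weight (l - k)).toNNReal with hc
  have hcc : ∀ l k, (c l k : ℝ) = K * D * weight (l - k) := fun l k =>
    Real.coe_toNNReal _ (mul_nonneg (by positivity) (weight_nonneg _))
  set A : ℝ≥0∞ := ENNReal.ofReal (K * D * W) with hA
  have hsubs : ∀ l, Summable fun k : Fin n → ℤ => K * D * weight (l - k) := fun l =>
    ((Equiv.subLeft l).summable_iff.2 summable_weight).mul_left _
  have hsubs' : ∀ k, Summable fun l : Fin n → ℤ => K * D * weight (l - k) := fun k =>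
    ((Equiv.subRight k).summable_iff.2 summable_weight).mul_left _
  have hcA : ∀ l, ∑' k, (c l k : ℝ≥0∞) = A := by
    intro l
    have h1 : ∀ k, (c l k : ℝ≥0∞) = ENNReal.ofReal (K * D * weight (l - k)) := fun _ => rfl
    simp_rw [h1]
    rw [← ENNReal.ofReal_tsum_of_nonneg (fun k => mul_nonneg (by positivity) (weight_nonneg _))
      (hsubs l), tsum_mul_left]
    exact congrArg (fun y => ENNReal.ofReal (K * D * y)) ((Equiv.subLeft l).tsum_eq weight)
  have hcA' : ∀ k, ∑' l, (c l k : ℝ≥0∞) = A := by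
    intro k
    have h1 : ∀ l, (c l k : ℝ≥0∞) = ENNReal.ofReal (K * D * weight (l - k)) := fun _ => rfl
    simp_rw [h1]
    rw [← ENNReal.ofReal_tsum_of_nonneg (fun k => mul_nonneg (by positivity) (weight_nonneg _))
      (hsubs' k), tsum_mul_left]
    exact congrArg (fun y => ENNReal.ofReal (K * D * y)) ((Equiv.subRight k).tsum_eq weight)
  -- The scalar is conjugated because the inner product is conjugate-linear in its first argument.
  set G : (Fin n → ℤ) → (Fin n → ℤ) → ℝ → L2 n := fun l k t =>
    (starRingEnd ℂ) q • mulL2 (cell r k) (testVec ψ α l ξ₀ t) with hG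
  have hGc : ∀ l k, ∀ t ∈ Icc (0 : ℝ) 1, ‖G l k t‖ ≤ c l k := by
    intro l k t ht
    rw [hG, norm_smul, RCLike.norm_conj, hqn]
    calc _ ≤ (∏ i, ((α i).factorial : ℝ))⁻¹ * (K * (2 * ρ) ^ (∑ i, α i) * weight (l - k)) := by
          gcongr; exact (hb α l k ξ₀).1 t ht
      _ = c l k := by rw [hcc, hD]; ring
  have hGL : ∀ l k, ∀ t ∈ Icc (0 : ℝ) 1, ∀ s ∈ Icc (0 : ℝ) 1,
      ‖G l k t - G l k s‖ ≤ c l k * |t - s| := by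
    intro l k t ht s hs
    rw [hG, ← smul_sub, norm_smul, RCLike.norm_conj, hqn]
    calc _ ≤ (∏ i, ((α i).factorial : ℝ))⁻¹ *
          (K * (2 * ρ) ^ (∑ i, α i) * weight (l - k) * |t - s|) := by
          gcongr; exact (hb α l k ξ₀).2 t ht s hs
      _ = c l k * |t - s| := by rw [hcc, hD]; ring
  have hfX : ∀ k, v2NormSq (piece φ u k) ≤ xNormSq φ u := fun k =>
    ENNReal.le_tsum (f := fun k => v2NormSq (piece φ u k)) k
  have hX := hu.2.ne
  have hsum : ∀ l, ∀ t ∈ Icc (0 : ℝ) 1,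
      HasSum (fun k => inner ℂ (G l k t) (piece φ u k t)) (taylorCoeff ψ α l ξ₀ u t) := by
    intro l t ht
    have h := hasSum_inner_cell hφ hr' (testVec ψ α l ξ₀ t) (schrodinger t (u t)) (by
      refine Summable.of_nonneg_of_le (fun k => by positivity) (fun k => ?_)
        ((((Equiv.subLeft l).summable_iff.2 summable_weight).mul_left
          (K * (2 * ρ) ^ (∑ i, α i))).mul_right (1 + (xNormSq φ u).toReal))
      refine mul_le_mul ((hb α l k ξ₀).1 t ht) ?_ (norm_nonneg _)
        (mul_nonneg (by positivity) (weight_nonneg _))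
      have h1 : ‖piece φ u k t‖ ^ 2 ≤ (xNormSq φ u).toReal := by
        rw [← ENNReal.ofReal_le_iff_le_toReal hX, ENNReal.ofReal_pow (norm_nonneg _), ofReal_norm]
        exact (enorm_sq_le_v2NormSq _ ht).trans (hfX k)
      change ‖piece φ u k t‖ ≤ _
      nlinarith [sq_nonneg (‖piece φ u k t‖ - 1), norm_nonneg (piece φ u k t)])
    have h2 : (fun k => inner ℂ (G l k t) (piece φ u k t)) = fun k => q * inner ℂ
        (mulL2 (cell r k) (testVec ψ α l ξ₀ t))
        (mulL2 (fun x => (φ (x - latticePt k) : ℂ)) (schrodinger t (u t))) := by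
      ext k
      simp only [hG, inner_smul_left, Complex.conj_conj, piece]
    rw [h2]
    exact h.mul_left q
  have hAt : A ≠ ⊤ := ENNReal.ofReal_ne_top
  have hv2 : ∀ l, v2NormSq (taylorCoeff ψ α l ξ₀ u) ≤
      3 * A * ∑' k, c l k * v2NormSq (piece φ u k) := fun l =>
    v2NormSq_tsum_inner_le (hcA l).le (hGc l) (hGL l) (hsum l)
  have htot : ∑' l, v2NormSq (taylorCoeff ψ α l ξ₀ u) ≤ 3 * A * (A * xNormSq φ u) := by
    refine (ENNReal.tsum_le_tsum hv2).trans ?_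
    rw [ENNReal.tsum_mul_left, ENNReal.tsum_comm]
    simp_rw [ENNReal.tsum_mul_right, hcA', ENNReal.tsum_mul_left]
    rfl
  have hmem : ∀ l, MemV2 (taylorCoeff ψ α l ξ₀ u) := fun l =>
    ⟨continuousOn_tsum_inner (hcA l).le hAt (hGc l) (hGL l) (hsum l) hX hfX
      fun k => (hu.1 k).1, lt_of_le_of_lt ((ENNReal.le_tsum (f := fun l =>
        v2NormSq (taylorCoeff ψ α l ξ₀ u)) l).trans htot) (by
          have := hu.2
          finiteness)⟩
  refine ⟨hmem, fun hcl l => ?_, htot.trans_eq ?_⟩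
  · refine memV2Closure_tsum_inner (hcA l).le hAt (hGc l) (hGL l) (hsum l) (hmem l) hX hfX
      (fun k => ?_) hcl.1
    obtain ⟨T, hT⟩ := exists_clm_cell (n := n) r k
    simp only [hG, ← hT]
    exact ((T.restrictScalars ℝ).contDiff.comp
      (contDiff_testVec hψ.continuous hs α l ξ₀)).const_smul _
  · rw [← mul_assoc]
    congr 1
    rw [mul_assoc, hA, ← ENNReal.ofReal_mul (by positivity),
      ← ENNReal.ofReal_ofNat, ← ENNReal.ofReal_mul (by norm_num)]
    congr 1
    ring

end

end

/-! ### Profiles: a lattice partition of unity times monomials. -/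

section

/-- A smooth function on `ℝ`, supported in `[-0.51, 0.51]`, whose integer translates sum to one. -/
def window (s : ℝ) : ℝ :=
  Real.smoothTransition (50 * (s + 1 / 2) + 1 / 2) - Real.smoothTransition (50 * (s - 1 / 2) + 1 / 2)

theorem contDiff_window : ContDiff ℝ ∞ window := by
  unfold window
  have h : ContDiff ℝ ∞ Real.smoothTransition := Real.smoothTransition.contDiff
  exact (h.comp (by fun_prop)).sub (h.comp (by fun_prop))

theorem window_eq_zero {s : ℝ} (hs : 51 / 100 < |s|) : window s = 0 := by
  unfold window
  rcases lt_abs.1 hs with h | h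
  · rw [Real.smoothTransition.one_of_one_le (by linarith),
      Real.smoothTransition.one_of_one_le (by linarith), sub_self]
  · rw [Real.smoothTransition.zero_of_nonpos (by linarith),
      Real.smoothTransition.zero_of_nonpos (by linarith), sub_self]

theorem abs_window_le (s : ℝ) : |window s| ≤ 1 := by
  unfold window
  have h := fun x => Real.smoothTransition.nonneg x
  have h' := fun x => Real.smoothTransition.le_one x
  rw [abs_le]
  constructor <;> linarith [h (50 * (s + 1 / 2) + 1 / 2), h (50 * (s - 1 / 2) + 1 / 2),
    h' (50 * (s + 1 / 2) + 1 / 2), h' (50 * (s - 1 / 2) + 1 / 2)]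

/-- Only the translates at ⌊s⌋ and ⌊s⌋ + 1 can be nonzero; their sum telescopes, the two inner
transitions cancelling and the outer ones being 1 and 0. -/
theorem hasSum_window (s : ℝ) : HasSum (fun m : ℤ => window (s - m)) 1 := by
  have h0 := Int.floor_le s
  have h1 := Int.lt_floor_add_one s
  have h := hasSum_sum_of_ne_finset_zero (s := {⌊s⌋, ⌊s⌋ + 1})
    (f := fun m : ℤ => window (s - m)) (L := .unconditional ℤ) (fun m hm => by
      simp only [Finset.mem_insert, Finset.mem_singleton, not_or] at hm
      refine window_eq_zero (lt_abs.2 ?_)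
      rcases lt_or_gt_of_ne hm.1 with h | h
      · left
        have : (m : ℝ) + 1 ≤ ⌊s⌋ := by exact_mod_cast h
        linarith
      · right
        have h2 : ⌊s⌋ + 2 ≤ m := by have := hm.2; omega
        have : (⌊s⌋ : ℝ) + 2 ≤ m := by exact_mod_cast h2
        linarith)
  rw [Finset.sum_pair (by simp)] at h
  convert! h using 1
  have e : s - ((⌊s⌋ + 1 : ℤ) : ℝ) + 1 / 2 = s - ⌊s⌋ - 1 / 2 := by push_cast; ring
  rw [window, window, e, Real.smoothTransition.one_of_one_le (by linarith),
    Real.smoothTransition.zero_of_nonpos (x := 50 * (s - ((⌊s⌋ + 1 : ℤ) : ℝ) - 1 / 2) + 1 / 2)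
      (by push_cast; linarith)]
  ring

/-- The window times a monomial, in one dimension. -/
def windowPow (a : ℕ) (s : ℝ) : ℝ := window s * s ^ a

theorem contDiff_windowPow (a : ℕ) : ContDiff ℝ ∞ (windowPow a) :=
  contDiff_window.mul (contDiff_id.pow a)

theorem windowPow_eq_zero (a : ℕ) {s : ℝ} (hs : 51 / 100 < |s|) : windowPow a s = 0 := by
  rw [windowPow, window_eq_zero hs, zero_mul]

theorem abs_windowPow_le (a : ℕ) (s : ℝ) : |windowPow a s| ≤ 1 := by
  rcases lt_or_ge (51 / 100) |s| with h | h
  · simp [windowPow_eq_zero a h]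
  · rw [windowPow, abs_mul, abs_pow]
    exact mul_le_one₀ (abs_window_le s) (by positivity)
      (pow_le_one₀ (abs_nonneg _) (h.trans (by norm_num)))

/-- The derivative is at most a constant times a^j (51/100)^a, bounded in a because 51/100 < 1. This
is what makes the profile bounds uniform in the multi-index. -/
theorem exists_iteratedFDeriv_pow_bound (j : ℕ) : ∃ B : ℝ, ∀ (a : ℕ) (s : ℝ), |s| ≤ 51 / 100 →
    ‖iteratedFDeriv ℝ j (fun s : ℝ => s ^ a) s‖ ≤ B := by
  obtain ⟨B, hB⟩ := (tendsto_pow_const_mul_const_pow_of_abs_lt_one j (r := 51 / 100)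
    (by rw [abs_lt]; norm_num)).bddAbove_range
  refine ⟨B * (100 / 51) ^ j, fun a s hs => ?_⟩
  rw [norm_iteratedFDeriv_eq_norm_iteratedDeriv, iteratedDeriv_pow, norm_mul, norm_pow,
    Real.norm_eq_abs, Real.norm_eq_abs, Nat.abs_cast]
  have h1 : ((a.descFactorial j : ℕ) : ℝ) ≤ (a : ℝ) ^ j := by
    exact_mod_cast Nat.descFactorial_le_pow a j
  have h2 : (51 / 100 : ℝ) ^ (a - j) ≤ (51 / 100) ^ a * (100 / 51) ^ j := by
    -- With truncated subtraction only a ≤ a - j + j holds in general, which suffices for a base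
    -- below 1.
    have h3 : (51 / 100 : ℝ) ^ (a - j + j) ≤ (51 / 100) ^ a :=
      pow_le_pow_of_le_one (by norm_num) (by norm_num) (by omega)
    calc (51 / 100 : ℝ) ^ (a - j) = (51 / 100 : ℝ) ^ (a - j + j) * (100 / 51) ^ j := by
          rw [pow_add, mul_assoc, ← mul_pow]; norm_num
      _ ≤ _ := by gcongr
  calc (a.descFactorial j : ℝ) * |s| ^ (a - j) ≤ (a : ℝ) ^ j * (51 / 100) ^ (a - j) := by gcongr
    _ ≤ (a : ℝ) ^ j * ((51 / 100) ^ a * (100 / 51) ^ j) := by gcongr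
    _ = ((a : ℝ) ^ j * (51 / 100) ^ a) * (100 / 51) ^ j := by ring
    _ ≤ B * (100 / 51) ^ j := by gcongr; exact hB ⟨a, rfl⟩

theorem exists_iteratedFDeriv_windowPow_bound (N : ℕ) : ∃ B : ℝ, ∀ (a : ℕ) (s : ℝ),
    ‖iteratedFDeriv ℝ N (windowPow a) s‖ ≤ B := by
  choose B hB using exists_iteratedFDeriv_pow_bound
  have hw : HasCompactSupport window := hasCompactSupport_of_abs fun η => window_eq_zero
  have hD : ∀ i, ∃ D : ℝ, ∀ s, ‖iteratedFDeriv ℝ i window s‖ ≤ D := fun i =>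
    (contDiff_window.continuous_iteratedFDeriv (m := i) (by exact_mod_cast le_top)
      ).bounded_above_of_compact_support (hw.iteratedFDeriv i)
  choose D hD using hD
  refine ⟨∑ i ∈ Finset.range (N + 1), (N.choose i : ℝ) * D i * B (N - i), fun a s => ?_⟩
  refine (norm_iteratedFDeriv_mul_le (N := ∞) contDiff_window (contDiff_id.pow a) s
    (by exact_mod_cast le_top)).trans (Finset.sum_le_sum fun i _ => ?_)
  have hD0 : 0 ≤ D i := (norm_nonneg _).trans (hD i 0)
  have hB0 : 0 ≤ B (N - i) := (norm_nonneg _).trans (hB (N - i) 0 0 (by norm_num))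
  rcases lt_or_ge (51 / 100) |s| with h | h
  · have : iteratedFDeriv ℝ i window s = 0 := by
      by_contra hne
      have h1 := support_iteratedFDeriv_subset (𝕜 := ℝ) (f := window) i hne
      have h2 : tsupport window ⊆ {s | |s| ≤ 51 / 100} :=
        closure_minimal (fun y hy => by
          by_contra hlt
          exact hy (window_eq_zero (not_le.1 hlt))) (isClosed_le continuous_abs continuous_const)
      exact absurd (h2 h1) (not_le.2 h)
    rw [this, norm_zero, mul_zero, zero_mul]
    positivity
  · exact mul_le_mul (mul_le_mul_of_nonneg_left (hD i s) (by positivity)) (hB (N - i) a s h)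
      (norm_nonneg _) (by positivity)

variable {n : ℕ}

/-- The wave packet profile: the partition function times a monomial. -/
def profile (α : Fin n → ℕ) (x : E n) : ℂ := ((∏ i, windowPow (α i) (x i) : ℝ) : ℂ)

theorem contDiff_profile (α : Fin n → ℕ) : ContDiff ℝ ∞ (profile α) :=
  Complex.ofRealCLM.contDiff.comp (g := Complex.ofRealCLM)
    (f := fun x : E n => ∏ i, windowPow (α i) (x i)) (contDiff_prod fun i _ =>
      (contDiff_windowPow (α i)).comp (contDiff_piLp_apply (p := 2)))

theorem norm_profile_le (α : Fin n → ℕ) (x : E n) : ‖profile α x‖ ≤ 1 := by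
  rw [profile, Complex.norm_real, norm_prod]
  exact Finset.prod_le_one (fun _ _ => norm_nonneg _) fun i _ => abs_windowPow_le (α i) (x i)

theorem abs_le_of_profile_ne_zero {α : Fin n → ℕ} {x : E n} (h : profile α x ≠ 0) (i : Fin n) :
    |x i| ≤ 51 / 100 := by
  by_contra hlt
  refine h ?_
  rw [profile, Finset.prod_eq_zero (Finset.mem_univ i) (windowPow_eq_zero _ (not_le.1 hlt)),
    Complex.ofReal_zero]

theorem tsupport_profile_subset (α : Fin n → ℕ) :
    tsupport (profile α) ⊆ {x | ∀ i, |x i| ≤ 51 / 100} := by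
  refine closure_minimal (fun x hx => abs_le_of_profile_ne_zero hx) ?_
  simp only [ofPred_forall]
  exact isClosed_iInter fun i => isClosed_le (by fun_prop) continuous_const

theorem norm_sq_le_of_abs_le {x : E n} (hx : ∀ i, |x i| ≤ 51 / 100) :
    ‖x‖ ^ 2 ≤ n * (51 / 100) ^ 2 := by
  rw [EuclideanSpace.real_norm_sq_eq]
  calc _ ≤ ∑ _i : Fin n, (51 / 100 : ℝ) ^ 2 :=
        Finset.sum_le_sum fun i _ => sq_le_sq' (abs_le.1 (hx i)).1 (abs_le.1 (hx i)).2
    _ = _ := by simp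

theorem norm_le_of_abs_le {x : E n} (hx : ∀ i, |x i| ≤ 51 / 100) : ‖x‖ ≤ n + 1 := by
  have h := norm_sq_le_of_abs_le hx
  have h1 : (0 : ℝ) ≤ n := n.cast_nonneg
  by_contra hlt
  nlinarith

/-- Numerically 15·(51/100)² = 3.9015 < 4. In dimension 16 the corners of the cube of half-width 1/2
already have Euclidean norm 2. -/
theorem tsupport_profile_subset_ball (α : Fin n → ℕ) :
    tsupport (profile α) ⊆ {x | (∀ i, |x i| < 2) ∧ (n ≤ 15 → ‖x‖ < 2)} := by
  intro x hx
  have h := tsupport_profile_subset α hx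
  refine ⟨fun i => (h i).trans_lt (by norm_num), fun hn => ?_⟩
  have h1 := norm_sq_le_of_abs_le h
  have h2 : (n : ℝ) ≤ 15 := by exact_mod_cast hn
  by_contra hlt
  nlinarith

theorem hasCompactSupport_profile (α : Fin n → ℕ) : HasCompactSupport (profile α) :=
  HasCompactSupport.intro (isCompact_closedBall (0 : E n) (n + 1)) fun x hx => by
    by_contra h
    exact hx (mem_closedBall_zero_iff.2 (norm_le_of_abs_le (abs_le_of_profile_ne_zero h)))

theorem exists_iteratedFDeriv_profile_bound (N : ℕ) : ∃ B : ℝ, ∀ (α : Fin n → ℕ) (x : E n),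
    ‖iteratedFDeriv ℝ N (profile α) x‖ ≤ B := by
  choose B hB using exists_iteratedFDeriv_windowPow_bound
  refine ⟨∑ p ∈ (Finset.univ : Finset (Fin n)).sym N, ((p : Multiset (Fin n)).countPerms : ℝ) *
    ∏ j, B ((p : Multiset (Fin n)).count j), fun α x => ?_⟩
  have hc : ∀ i : Fin n, ContDiff ℝ ∞ fun x : E n => windowPow (α i) (x i) := fun i =>
    (contDiff_windowPow (α i)).comp (contDiff_piLp_apply (p := 2))
  have h1 := Complex.ofRealLI.norm_iteratedFDeriv_comp_left (x := x) (i := N)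
    (contDiff_prod (t := Finset.univ) fun i _ => hc i).contDiffAt (by exact_mod_cast le_top)
  have h2 : profile α = Complex.ofRealLI ∘ fun x : E n => ∏ i, windowPow (α i) (x i) := rfl
  rw [h2, h1]
  refine (norm_iteratedFDeriv_prod_le (N := ∞) (fun i _ => hc i)
    (by exact_mod_cast le_top)).trans (Finset.sum_le_sum fun p _ => ?_)
  gcongr with j
  set m := (p : Multiset (Fin n)).count j
  have h3 : (fun x : E n => windowPow (α j) (x j)) =
      windowPow (α j) ∘ (EuclideanSpace.proj j : E n →L[ℝ] ℝ) := rfl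
  rw [h3, ContinuousLinearMap.iteratedFDeriv_comp_right _ (contDiff_windowPow (α j)) x
    (by exact_mod_cast le_top)]
  refine (ContinuousMultilinearMap.norm_compContinuousLinearMap_le _ _).trans ?_
  have h4 : ‖(EuclideanSpace.proj j : E n →L[ℝ] ℝ)‖ ≤ 1 :=
    ContinuousLinearMap.opNorm_le_bound _ zero_le_one fun y => by
      simpa using PiLp.norm_apply_le y j
  refine (mul_le_of_le_one_right (norm_nonneg _)
    (Finset.prod_le_one (fun _ _ => norm_nonneg _) fun _ _ => h4)).trans (hB m _ _)

/-- Both weighted terms are L² norms of continuous linear images of a Schwartz function, so finitely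
many Schwartz seminorms control them. No decay of the Fourier transform of a profile has to be
computed. -/
theorem exists_hNorm_le_seminorm (n N : ℕ) : ∃ (s : Finset (ℕ × ℕ)) (C : ℝ), 0 ≤ C ∧
    ∀ f : SchwartzMap (E n) ℂ, hNorm N (toL2 f) ≤
      ENNReal.ofReal (C * (s.sup (schwartzSeminormFamily ℂ (E n) ℂ)) f) := by
  classical
  set g : E n → ℂ := fun x => (((1 + ‖x‖ ^ 2) ^ ((N : ℝ) / 2) : ℝ) : ℂ) with hg
  have hgt : g.HasTemperateGrowth :=
    Function.HasTemperateGrowth.comp Function.Complex.hasTemperateGrowth_ofReal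
      (Function.hasTemperateGrowth_one_add_norm_sq_rpow (E n) ((N : ℝ) / 2))
  have hgt' : (fun ζ : E n => g ((2 * Real.pi) • ζ)).HasTemperateGrowth :=
    hgt.comp (ContinuousLinearMap.hasTemperateGrowth ((2 * Real.pi) • ContinuousLinearMap.id ℝ (E n)))
  have hge : ∀ x, (Real.sqrt (1 + ‖x‖ ^ 2) : ℂ) ^ N = g x := by
    intro x
    rw [hg, ← Complex.ofReal_pow, Real.sqrt_eq_rpow, ← Real.rpow_natCast, ← Real.rpow_mul
      (by positivity)]
    ring_nf
  set T₁ : SchwartzMap (E n) ℂ →L[ℂ] L2 n := (SchwartzMap.toLpCLM ℂ ℂ 2 volume).comp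
    ((SchwartzMap.smulLeftCLM ℂ fun ζ : E n => g ((2 * Real.pi) • ζ)).comp
      (FourierTransform.fourierCLM ℂ (SchwartzMap (E n) ℂ))) with hT₁
  set T₂ : SchwartzMap (E n) ℂ →L[ℂ] L2 n := (SchwartzMap.toLpCLM ℂ ℂ 2 volume).comp
    (SchwartzMap.smulLeftCLM ℂ g) with hT₂
  have hbd : ∀ T : SchwartzMap (E n) ℂ →L[ℂ] L2 n, ∃ (s : Finset (ℕ × ℕ)) (C : ℝ), 0 ≤ C ∧
      ∀ f, ‖T f‖ ≤ C * (s.sup (schwartzSeminormFamily ℂ (E n) ℂ)) f := by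
    intro T
    obtain ⟨s, C, -, h⟩ := Seminorm.bound_of_continuous
      (schwartz_withSeminorms ℂ (E n) ℂ) ((normSeminorm ℂ (L2 n)).comp T.toLinearMap)
      (continuous_norm.comp T.continuous)
    exact ⟨s, C, C.2, fun f => h f⟩
  obtain ⟨s₁, C₁, hC₁, h₁⟩ := hbd T₁
  obtain ⟨s₂, C₂, hC₂, h₂⟩ := hbd T₂
  refine ⟨s₁ ∪ s₂, C₁ + C₂, by positivity, fun f => ?_⟩
  have hf : toL2 (f : E n → ℂ) = f.toLp 2 := by
    rw [toL2, dif_pos (f.memLp 2 volume)]; rfl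
  have e₁ : eLpNorm (fun ζ => (Real.sqrt (1 + ‖(2 * Real.pi) • ζ‖ ^ 2) : ℂ) ^ N *
      (𝓕 (toL2 f) : L2 n) ζ) 2 volume = ‖T₁ f‖ₑ := by
    rw [Lp.enorm_def]
    refine eLpNorm_congr_ae ?_
    rw [hf, SchwartzMap.toLp_fourier_eq]
    filter_upwards [SchwartzMap.coeFn_toLp (𝓕 f) 2 volume,
      SchwartzMap.coeFn_toLp (SchwartzMap.smulLeftCLM ℂ (fun ζ : E n => g ((2 * Real.pi) • ζ))
        (𝓕 f)) 2 volume] with ζ hζ hζ'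
    rw [hge, hζ]
    refine Eq.trans ?_ hζ'.symm
    rw [SchwartzMap.smulLeftCLM_apply_apply hgt', smul_eq_mul]
  have e₂ : eLpNorm (fun x => (Real.sqrt (1 + ‖x‖ ^ 2) : ℂ) ^ N * (toL2 f) x) 2 volume =
      ‖T₂ f‖ₑ := by
    rw [Lp.enorm_def]
    refine eLpNorm_congr_ae ?_
    rw [hf]
    filter_upwards [SchwartzMap.coeFn_toLp f 2 volume,
      SchwartzMap.coeFn_toLp (SchwartzMap.smulLeftCLM ℂ g f) 2 volume] with ζ hζ hζ'
    rw [hge, hζ]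
    refine Eq.trans ?_ hζ'.symm
    rw [SchwartzMap.smulLeftCLM_apply_apply hgt, smul_eq_mul]
  rw [hNorm, e₁, e₂, ← ofReal_norm, ← ofReal_norm,
    ← ENNReal.ofReal_add (norm_nonneg _) (norm_nonneg _), add_mul]
  refine ENNReal.ofReal_le_ofReal (add_le_add ((h₁ f).trans ?_) ((h₂ f).trans ?_))
  · gcongr
    exact Finset.sup_mono Finset.subset_union_left (f := schwartzSeminormFamily ℂ (E n) ℂ) f
  · gcongr
    exact Finset.sup_mono Finset.subset_union_right (f := schwartzSeminormFamily ℂ (E n) ℂ) f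

theorem exists_hNorm_profile_bound (n N : ℕ) : ∃ C : ℝ≥0, ∀ α : Fin n → ℕ,
    hNorm N (toL2 (profile α)) ≤ C := by
  obtain ⟨s, C, hC, h⟩ := exists_hNorm_le_seminorm n N
  choose B hB using exists_iteratedFDeriv_profile_bound (n := n)
  have hB0 : ∀ m, 0 ≤ B m := fun m => (norm_nonneg _).trans (hB m 0 0)
  refine ⟨(C * ∑ p ∈ s, ((n : ℝ) + 1) ^ p.1 * B p.2).toNNReal, fun α => ?_⟩
  refine (h ((hasCompactSupport_profile α).toSchwartzMap (contDiff_profile α))).trans ?_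
  refine ENNReal.ofReal_le_ofReal (mul_le_mul_of_nonneg_left ?_ hC)
  refine Seminorm.finset_sup_apply_le
    (Finset.sum_nonneg fun p _ => mul_nonneg (by positivity) (hB0 _)) fun p hp => ?_
  refine (SchwartzMap.seminorm_le_bound ℂ p.1 p.2 _
    (mul_nonneg (by positivity : (0 : ℝ) ≤ ((n : ℝ) + 1) ^ p.1) (hB0 p.2)) fun x => ?_).trans
    (Finset.single_le_sum (f := fun p : ℕ × ℕ => ((n : ℝ) + 1) ^ p.1 * B p.2)
      (fun p _ => mul_nonneg (by positivity) (hB0 _)) hp)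
  change ‖x‖ ^ p.1 * ‖iteratedFDeriv ℝ p.2 (profile α) x‖ ≤ _
  by_cases hx : iteratedFDeriv ℝ p.2 (profile α) x = 0
  · rw [hx, norm_zero, mul_zero]
    exact mul_nonneg (by positivity) (hB0 _)
  · have h1 := norm_le_of_abs_le (tsupport_profile_subset α
      (support_iteratedFDeriv_subset (𝕜 := ℝ) p.2 hx))
    gcongr
    exact hB p.2 α x

end

/-! ### Multi-indices and the Taylor expansion. -/

section

/-- Iterating the pairing function adds one coordinate at a time; a pair's code is below (max + 1)²,
so each step doubles the exponent. The induction starts at n = 1, since n = 0 has a single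
multi-index. -/
theorem exists_multiIndex_equiv {n : ℕ} (hn : 1 ≤ n) : ∃ (e : (Fin n → ℕ) ≃ ℕ) (p : ℕ), 1 ≤ p ∧
    ∀ α, e α + 1 ≤ (∑ i, α i + 1) ^ p := by
  induction n, hn using Nat.le_induction with
  | base => exact ⟨Equiv.funUnique (Fin 1) ℕ, 1, le_rfl, fun α => by simp⟩
  | succ n _ ih =>
    obtain ⟨e, p, hp, he⟩ := ih
    refine ⟨(Fin.consEquiv fun _ => ℕ).symm.trans
      (((Equiv.refl ℕ).prodCongr e).trans Nat.pairEquiv), p * 2, by omega, fun α => ?_⟩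
    have h1 : ((Fin.consEquiv fun _ => ℕ).symm.trans
      (((Equiv.refl ℕ).prodCongr e).trans Nat.pairEquiv)) α =
        Nat.pair (α 0) (e fun i => α i.succ) := rfl
    have h2 := Nat.pair_lt_max_add_one_sq (α 0) (e fun i => α i.succ)
    have h3 := he fun i => α i.succ
    rw [h1, Fin.sum_univ_succ, pow_mul]
    refine (Nat.succ_le_of_lt h2).trans (Nat.pow_le_pow_left ?_ 2)
    rw [← max_add_add_right]
    refine max_le ?_ (h3.trans (Nat.pow_le_pow_left (by omega) p))
    calc α 0 + 1 ≤ (α 0 + ∑ i : Fin n, α i.succ + 1) ^ 1 := by rw [pow_one]; omega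
      _ ≤ _ := Nat.pow_le_pow_right (by omega) hp

variable {n : ℕ}

/-- The size `∏ Λ^{αᵢ} / αᵢ!` of a Taylor coefficient. -/
def taylorSize (Λ : ℝ) (α : Fin n → ℕ) : ℝ := Λ ^ (∑ i, α i) / ∏ i, ((α i).factorial : ℝ)

theorem taylorSize_eq_prod (Λ : ℝ) (α : Fin n → ℕ) :
    taylorSize Λ α = ∏ i, Λ ^ (α i) / ((α i).factorial : ℝ) := by
  rw [taylorSize, Finset.prod_div_distrib, Finset.prod_pow_eq_pow_sum]

theorem taylorSize_pos {Λ : ℝ} (hΛ : 0 < Λ) (α : Fin n → ℕ) : 0 < taylorSize Λ α := by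
  unfold taylorSize; positivity

theorem summable_taylorSize (Λ : ℝ) : Summable (taylorSize Λ : (Fin n → ℕ) → ℝ) := by
  simp_rw [funext (taylorSize_eq_prod (n := n) Λ)]
  exact (hasSum_prod_pi (fun _ => (Real.summable_pow_div_factorial Λ).hasSum)
    fun _ => (Real.summable_pow_div_factorial Λ).norm).1.summable

/-- The bound |α| + 1 ≤ 2^{|α|} makes the polynomial factor split over coordinates; each coordinate
then gives at most (Λ² 2^M)^a / a!, which is bounded in a. -/
theorem exists_taylorSize_decay {Λ : ℝ} (hΛ : 0 < Λ) (M : ℕ) : ∃ B : ℝ, 0 ≤ B ∧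
    ∀ α : Fin n → ℕ, taylorSize Λ α ^ 2 * ((∑ i, α i + 1 : ℕ) : ℝ) ^ M ≤ B := by
  obtain ⟨B, hB⟩ :=
    (FloorSemiring.tendsto_pow_div_factorial_atTop (Λ ^ 2 * 2 ^ M)).bddAbove_range
  have hB' : ∀ a : ℕ, (Λ ^ 2 * 2 ^ M) ^ a / (a.factorial : ℝ) ≤ B := fun a => hB ⟨a, rfl⟩
  have hB0 : 0 ≤ B := le_trans (by positivity) (hB' 0)
  refine ⟨B ^ n, by positivity, fun α => ?_⟩
  have h1 : ((∑ i, α i + 1 : ℕ) : ℝ) ≤ ∏ i, (2 : ℝ) ^ (α i) := by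
    rw [Finset.prod_pow_eq_pow_sum]
    exact_mod_cast Nat.lt_two_pow_self
  calc taylorSize Λ α ^ 2 * ((∑ i, α i + 1 : ℕ) : ℝ) ^ M
      ≤ taylorSize Λ α ^ 2 * (∏ i, (2 : ℝ) ^ (α i)) ^ M := by gcongr
    _ = ∏ i, (Λ ^ (α i) / ((α i).factorial : ℝ)) ^ 2 * ((2 : ℝ) ^ (α i)) ^ M := by
        rw [taylorSize_eq_prod, Finset.prod_mul_distrib, Finset.prod_pow, Finset.prod_pow]
    _ ≤ ∏ _i : Fin n, B := by
        refine Finset.prod_le_prod (fun i _ => by positivity) fun i _ => ?_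
        refine le_trans ?_ (hB' (α i))
        have hf : (1 : ℝ) ≤ (α i).factorial := by exact_mod_cast (α i).factorial_pos
        calc (Λ ^ (α i) / ((α i).factorial : ℝ)) ^ 2 * ((2 : ℝ) ^ (α i)) ^ M
            = (Λ ^ 2 * 2 ^ M) ^ (α i) / ((α i).factorial : ℝ) ^ 2 := by
              rw [mul_pow, ← pow_mul, ← pow_mul, ← pow_mul, div_pow, ← pow_mul,
                mul_comm 2 (α i), mul_comm M (α i)]
              ring
          _ ≤ (Λ ^ 2 * 2 ^ M) ^ (α i) / ((α i).factorial : ℝ) := by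
              gcongr
              exact le_self_pow₀ hf two_ne_zero
    _ = B ^ n := by simp

section

variable {ψ : ℝ → ℝ} {ρ R : ℝ}

/-- The exponential series of e^{i r_i η_i} are multiplied over the coordinates. Since |η| ≤ R, the
cutoff equals 1 and does not disturb the expansion. -/
theorem hasSum_taylor_testSymbol (h1 : ∀ η, |η| ≤ R → ψ η = 1) (l : Fin n → ℤ) (ξ₀ : E n) (t : ℝ)
    (r ζ : E n) (hζ : ‖(2 * Real.pi) • ζ - ξ₀‖ ≤ R) :
    HasSum (fun α : Fin n → ℕ => Complex.I ^ (∑ i, α i) / (∏ i, ((α i).factorial : ℂ)) *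
      (∏ i, (r i : ℂ) ^ (α i)) * (starRingEnd ℂ) (testSymbol ψ α l ξ₀ t ζ))
      (Complex.exp (∑ i, Complex.I * ((r i + l i) * (2 * Real.pi * ζ i - ξ₀ i) +
        t * (2 * Real.pi * ζ i - ξ₀ i) ^ 2 : ℝ))) := by
  set η : Fin n → ℝ := fun i => 2 * Real.pi * ζ i - ξ₀ i with hη
  have hψη : ∀ i, ψ (η i) = 1 := fun i => h1 _ (by
    have := (PiLp.norm_apply_le ((2 * Real.pi) • ζ - ξ₀) i).trans hζ
    rwa [coord_freq, Real.norm_eq_abs] at this)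
  set A : Fin n → ℂ := fun i => Complex.exp (Complex.I * (l i : ℝ) * (η i : ℂ)) *
    Complex.exp (Complex.I * t * (η i : ℂ) ^ 2) with hA
  have hs : ∀ i, HasSum (fun a : ℕ => (Complex.I * r i * η i) ^ a / (a.factorial : ℂ) * A i)
      (Complex.exp (Complex.I * r i * η i) * A i) := fun i => by
    have := (NormedSpace.expSeries_div_hasSum_exp (Complex.I * r i * η i : ℂ)).mul_right (A i)
    rwa [← Complex.exp_eq_exp_ℂ] at this
  have hsn : ∀ i, Summable fun a : ℕ =>
      ‖(Complex.I * r i * η i) ^ a / (a.factorial : ℂ) * A i‖ := fun i => by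
    simp_rw [norm_mul]
    exact (NormedSpace.norm_expSeries_div_summable (Complex.I * r i * η i : ℂ)).mul_right _
  convert! (hasSum_prod_pi hs hsn).1 using 1
  · ext α
    rw [← Finset.prod_pow_eq_pow_sum, ← Finset.prod_div_distrib, ← Finset.prod_mul_distrib,
      testSymbol, map_prod, ← Finset.prod_mul_distrib]
    refine Finset.prod_congr rfl fun i _ => ?_
    rw [Complex.conj_conj, symbol]
    change _ * _ * (Complex.exp (Complex.I * (l i : ℝ) * (η i : ℂ)) *
      ((ψ (η i) : ℂ) * (η i : ℂ) ^ (α i) * Complex.exp (Complex.I * t * (η i : ℂ) ^ 2))) = _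
    rw [hψη, hA, mul_pow, mul_pow]
    push_cast
    ring
  · rw [Complex.exp_sum]
    refine Finset.prod_congr rfl fun i _ => ?_
    simp only [hA, hη]
    rw [← Complex.exp_add, ← Complex.exp_add]
    congr 1
    push_cast
    ring

theorem integrable_fourier_of_localized {ξ₀ : E n} {f : L2 n}
    (hf : ∀ᵐ ζ : E n, R < ‖(2 * Real.pi) • ζ - ξ₀‖ → (𝓕 f : L2 n) ζ = 0) :
    Integrable (𝓕 f : L2 n) := by
  set S : Set (E n) := Metric.closedBall 0 ((R + ‖ξ₀‖) / (2 * Real.pi)) with hS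
  have h1 : IntegrableOn (𝓕 f : L2 n) S := by
    have : IsFiniteMeasure ((volume : Measure (E n)).restrict S) :=
      ⟨by rw [Measure.restrict_apply_univ]; exact (isCompact_closedBall _ _).measure_lt_top⟩
    exact ((Lp.memLp (𝓕 f : L2 n)).restrict S).integrable (by norm_num)
  refine ((integrable_indicator_iff Metric.isClosed_closedBall.measurableSet).2 h1).congr ?_
  · filter_upwards [hf] with ζ hζ
    by_cases h : ζ ∈ S
    · exact Set.indicator_of_mem h _
    · rw [Set.indicator_of_notMem h, hζ]
      by_contra hle
      refine h (mem_closedBall_zero_iff.2 ?_)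
      rw [le_div_iff₀ (by positivity)]
      have h2 : ‖(2 * Real.pi) • ζ‖ ≤ ‖(2 * Real.pi) • ζ - ξ₀‖ + ‖ξ₀‖ := by
        simpa using norm_add_le ((2 * Real.pi) • ζ - ξ₀) ξ₀
      rw [norm_smul, Real.norm_eq_abs, abs_of_pos (by positivity)] at h2
      linarith [not_lt.1 hle]

/-- By Plancherel the pairing is an integral over frequency, where the series in α can be summed
under the integral sign. -/
theorem taylorCoeff_eq_integral (hψ : Continuous ψ) (hs : ∀ η, ρ < |η| → ψ η = 0)
    (α : Fin n → ℕ) (l : Fin n → ℤ) (ξ₀ : E n) (u : ℝ → L2 n) (t : ℝ) :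
    taylorCoeff ψ α l ξ₀ u t = ∫ ζ, Complex.I ^ (∑ i, α i) / (∏ i, ((α i).factorial : ℂ)) *
      ((starRingEnd ℂ) (testSymbol ψ α l ξ₀ t ζ) *
        (Complex.exp (-(Complex.I * t * (‖(2 * Real.pi) • ζ‖ : ℂ) ^ 2)) *
          (𝓕 (u t) : L2 n) ζ)) := by
  rw [taylorCoeff, integral_const_mul, ← Lp.inner_fourier_eq, testVec,
    FourierTransform.fourier_fourierInv_eq, L2.inner_def]
  congr 1
  refine integral_congr_ae ?_
  filter_upwards [toL2_coe (memLp_testSymbol hψ hs α l ξ₀ t), fourier_schrodinger t (u t)]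
    with ζ h1 h2
  rw [h1, h2, RCLike.inner_apply, mul_comm]

/-- Taylor expansion of a frequency localized solution at a point of a tube. -/
theorem hasSum_taylorCoeff (hψ : Continuous ψ) (hs : ∀ η, ρ < |η| → ψ η = 0)
    (h1 : ∀ η, |η| ≤ R → ψ η = 1) {ξ₀ : E n} {u : ℝ → L2 n} {t : ℝ}
    (hu : ∀ᵐ ζ : E n, R < ‖(2 * Real.pi) • ζ - ξ₀‖ → (𝓕 (u t) : L2 n) ζ = 0)
    (l : Fin n → ℤ) (x : E n) :
    HasSum (fun α : Fin n → ℕ => taylorCoeff ψ α l ξ₀ u t *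
      ∏ i, (((x + (2 * t) • ξ₀ - latticePt l) i : ℝ) : ℂ) ^ (α i))
      (Complex.exp (-(Complex.I * (inner ℝ x ξ₀ : ℝ))) *
        Complex.exp (-(Complex.I * t * (‖ξ₀‖ : ℂ) ^ 2)) * 𝓕⁻ ((𝓕 (u t) : L2 n) : E n → ℂ) x) := by
  set r : E n := x + (2 * t) • ξ₀ - latticePt l with hr
  set v : E n → ℂ := ((𝓕 (u t) : L2 n) : E n → ℂ) with hv
  have hvi : Integrable v := integrable_fourier_of_localized hu
  set q : (Fin n → ℕ) → ℂ := fun α => Complex.I ^ (∑ i, α i) / (∏ i, ((α i).factorial : ℂ)) with hq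
  set F : (Fin n → ℕ) → E n → ℂ := fun α ζ => q α * (∏ i, (r i : ℂ) ^ (α i)) *
    (starRingEnd ℂ) (testSymbol ψ α l ξ₀ t ζ) *
    (Complex.exp (-(Complex.I * t * (‖(2 * Real.pi) • ζ‖ : ℂ) ^ 2)) * v ζ) with hF
  -- Since |η_i| ≤ R where `v` lives, the products of exponential series in |r_i| R give a summable
  -- majorant; `v` is integrable because it is in L² with bounded support.
  set β : (Fin n → ℕ) → ℝ := fun α => ∏ i, (|r i| * R) ^ (α i) / ((α i).factorial : ℝ) with hβ
  have hβs : Summable β := (hasSum_prod_pi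
    (fun i => (Real.summable_pow_div_factorial (|r i| * R)).hasSum)
    fun i => (Real.summable_pow_div_factorial (|r i| * R)).norm).1.summable
  have hpt : ∀ᵐ ζ : E n, HasSum (fun α => F α ζ)
      (Complex.exp (-(Complex.I * (inner ℝ x ξ₀ : ℝ))) *
        Complex.exp (-(Complex.I * t * (‖ξ₀‖ : ℂ) ^ 2)) *
        (Complex.exp (((2 * Real.pi * inner ℝ ζ x : ℝ) : ℂ) * Complex.I) • v ζ)) := by
    filter_upwards [hu] with ζ hζ
    rcases lt_or_ge R ‖(2 * Real.pi) • ζ - ξ₀‖ with h | h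
    · have h0 : v ζ = 0 := hζ h
      simp [hF, h0]
    · have h2 := (hasSum_taylor_testSymbol h1 l ξ₀ t r ζ h).mul_right
        (Complex.exp (-(Complex.I * t * (‖(2 * Real.pi) • ζ‖ : ℂ) ^ 2)) * v ζ)
      convert! h2 using 1
      -- Galilean identity: r + l = x + 2tξ₀ and |η|² - |ξ|² = -2η·ξ₀ - |ξ₀|², so the total phase is
      -- x·ξ - x·ξ₀ - t|ξ₀|².
      rw [smul_eq_mul, ← mul_assoc, ← mul_assoc, ← Complex.exp_add, ← Complex.exp_add,
        ← Complex.exp_add]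
      congr 2
      have n1 : (‖ξ₀‖ : ℂ) ^ 2 = ((∑ i, ξ₀ i ^ 2 : ℝ) : ℂ) := by
        rw [← EuclideanSpace.real_norm_sq_eq, Complex.ofReal_pow]
      have n2 : (‖(2 * Real.pi) • ζ‖ : ℂ) ^ 2 = ((∑ i, (2 * Real.pi * ζ i) ^ 2 : ℝ) : ℂ) := by
        rw [← Complex.ofReal_pow, EuclideanSpace.real_norm_sq_eq]
        simp
      rw [n1, n2, PiLp.inner_apply, PiLp.inner_apply]
      simp only [RCLike.inner_apply, conj_trivial, Complex.ofReal_sum, Finset.mul_sum,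
        Complex.ofReal_mul, Finset.sum_mul]
      rw [← Finset.sum_neg_distrib, ← Finset.sum_neg_distrib, ← Finset.sum_neg_distrib,
        ← Finset.sum_add_distrib, ← Finset.sum_add_distrib, ← Finset.sum_add_distrib]
      refine Finset.sum_congr rfl fun i _ => ?_
      have hri : r i = x i + 2 * t * ξ₀ i - l i := by simp [hr, latticePt]
      rw [hri]
      push_cast
      ring
  have hbd : ∀ α, ∀ᵐ ζ : E n, ‖F α ζ‖ ≤ β α * ‖v ζ‖ := by
    intro α
    filter_upwards [hu] with ζ hζ
    rcases lt_or_ge R ‖(2 * Real.pi) • ζ - ξ₀‖ with h | h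
    · have h0 : v ζ = 0 := hζ h
      simp [hF, h0]
    · simp only [hF, norm_mul, Complex.norm_exp]
      have e1 : (-(Complex.I * t * (‖(2 * Real.pi) • ζ‖ : ℂ) ^ 2)).re = 0 := by
        simp [← Complex.ofReal_pow]
      rw [e1, Real.exp_zero, one_mul]
      refine mul_le_mul_of_nonneg_right ?_ (norm_nonneg _)
      rw [RCLike.norm_conj, testSymbol, norm_prod, norm_prod, hq, norm_div, norm_pow,
        Complex.norm_I, one_pow, norm_prod, one_div, ← Finset.prod_inv_distrib,
        ← Finset.prod_mul_distrib, ← Finset.prod_mul_distrib]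
      refine Finset.prod_le_prod (fun _ _ => by positivity) fun i _ => ?_
      have hηi : |2 * Real.pi * ζ i - ξ₀ i| ≤ R := by
        have := (PiLp.norm_apply_le ((2 * Real.pi) • ζ - ξ₀) i).trans h
        rwa [coord_freq, Real.norm_eq_abs] at this
      rw [RCLike.norm_conj, norm_mul, norm_exp_I_mul, one_mul, symbol, norm_mul,
        norm_exp_I_mul_sq, mul_one, h1 _ hηi, Complex.ofReal_one, one_mul, norm_pow, norm_pow,
        Complex.norm_real, Complex.norm_real, Complex.norm_natCast, Real.norm_eq_abs,
        Real.norm_eq_abs]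
      rw [mul_pow, div_eq_inv_mul, mul_assoc]
      gcongr
  have h3 := hasSum_integral_of_dominated_convergence (μ := volume) (F := F)
    (fun α ζ => β α * ‖v ζ‖) (fun α => ?_) hbd
    (Eventually.of_forall fun ζ => hβs.mul_right _) ?_ hpt
  · rw [integral_const_mul, ← Real.fourierInv_eq'] at h3
    convert! h3 using 2 with α
    rw [taylorCoeff_eq_integral hψ hs, ← integral_mul_const]
    refine integral_congr_ae (Eventually.of_forall fun ζ => ?_)
    simp only [hF, hq, hv]
    ring
  · have hc := continuous_testSymbol (n := n) hψ α l ξ₀ t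
    refine AEStronglyMeasurable.mul (Continuous.aestronglyMeasurable ?_)
      (AEStronglyMeasurable.mul (Continuous.aestronglyMeasurable (by fun_prop)) hvi.1)
    exact continuous_const.mul (Complex.continuous_conj.comp hc)
  · simp_rw [tsum_mul_right]
    exact hvi.norm.const_mul _

end

end

/-! ### Gluing the expansions and convergence in L². -/

section

variable {n : ℕ}

/-- The lattice points whose cell may contain `y`. -/
def nearPts (y : E n) : Finset (Fin n → ℤ) := Fintype.piFinset fun i => {⌊y i⌋, ⌊y i⌋ + 1}

theorem card_nearPts_le (y : E n) : (nearPts y).card ≤ 2 ^ n := by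
  rw [nearPts, Fintype.card_piFinset]
  calc _ ≤ ∏ _i : Fin n, 2 := Finset.prod_le_prod' fun i _ => Finset.card_le_two
    _ = 2 ^ n := by simp

theorem mem_nearPts_of_abs_le {y : E n} {l : Fin n → ℤ}
    (h : ∀ i, |(y - latticePt l) i| ≤ 51 / 100) : l ∈ nearPts y := by
  rw [nearPts, Fintype.mem_piFinset]
  intro i
  have h1 := Int.floor_le (y i)
  have h2 := Int.lt_floor_add_one (y i)
  have h3 : |y i - l i| ≤ 51 / 100 := by simpa [latticePt] using h i
  rw [abs_le] at h3
  have h4 : ⌊y i⌋ - 1 < l i := by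
    have : ((⌊y i⌋ - 1 : ℤ) : ℝ) < l i := by push_cast; linarith
    exact_mod_cast this
  have h5 : l i < ⌊y i⌋ + 2 := by
    have : (l i : ℝ) < (⌊y i⌋ + 2 : ℤ) := by push_cast; linarith
    exact_mod_cast this
  simp only [Finset.mem_insert, Finset.mem_singleton]
  omega

theorem profile_eq_mul (α : Fin n → ℕ) (z : E n) :
    profile α z = (∏ i, (window (z i) : ℂ)) * ∏ i, ((z i : ℝ) : ℂ) ^ (α i) := by
  rw [profile, ← Finset.prod_mul_distrib]
  simp [windowPow]

theorem sum_nearPts_window (y : E n) :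
    ∑ l ∈ nearPts y, ∏ i, (window ((y - latticePt l) i) : ℂ) = 1 := by
  have hs : ∀ i : Fin n, HasSum (fun m : ℤ => (window (y i - m) : ℂ)) 1 := fun i => by
    exact_mod_cast (hasSum_window (y i)).mapL Complex.ofRealCLM
  have h1 := (hasSum_prod_pi hs fun i => (hs i).summable.norm).1
  rw [Finset.prod_const_one] at h1
  have h2 : ∀ l : Fin n → ℤ, ∏ i, (window (y i - l i) : ℂ) =
      ∏ i, (window ((y - latticePt l) i) : ℂ) := fun l => by simp [latticePt]
  simp_rw [h2] at h1
  refine HasSum.unique (hasSum_sum_of_ne_finset_zero fun l hl => ?_) h1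
  have h3 : ∃ i, 51 / 100 < |(y - latticePt l) i| := by
    by_contra! h
    exact hl (mem_nearPts_of_abs_le h)
  obtain ⟨i, hi⟩ := h3
  exact Finset.prod_eq_zero (Finset.mem_univ i) (by rw [window_eq_zero hi, Complex.ofReal_zero])

/-- The expansions about all lattice points have the same sum `z`, so weighting them by a partition
of unity returns `z`. Only the finitely many points of `nearPts y` contribute, so the double series
is a finite sum of convergent series. -/
theorem hasSum_mul_profile {y : E n} {z : ℂ} {c : (Fin n → ℕ) → (Fin n → ℤ) → ℂ}
    (h : ∀ l, HasSum (fun α => c α l * ∏ i, (((y - latticePt l) i : ℝ) : ℂ) ^ (α i)) z) :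
    HasSum (fun p : (Fin n → ℕ) × (Fin n → ℤ) => c p.1 p.2 * profile p.1 (y - latticePt p.2)) z := by
  classical
  set f : (Fin n → ℕ) × (Fin n → ℤ) → ℂ :=
    fun p => c p.1 p.2 * profile p.1 (y - latticePt p.2) with hf
  set Θ : (Fin n → ℤ) → ℂ := fun l => ∏ i, (window ((y - latticePt l) i) : ℂ) with hΘ
  have h1 : ∀ l, HasSum (fun p : (Fin n → ℕ) × (Fin n → ℤ) => if p.2 = l then f p else 0)
      (Θ l * z) := by
    intro l
    have hinj : Function.Injective fun α : Fin n → ℕ => (α, l) := fun a b hab => (Prod.ext_iff.1 hab).1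
    rw [← hinj.hasSum_iff]
    · convert! (h l).mul_left (Θ l) using 2 with α
      simp only [Function.comp_apply, if_true, hf, hΘ, profile_eq_mul]
      ring
    · intro p hp
      have : p.2 ≠ l := fun hpl => hp ⟨p.1, by rw [← hpl]⟩
      simp [this]
  have h2 := hasSum_sum (s := nearPts y) fun l _ => h1 l
  rw [← Finset.sum_mul, sum_nearPts_window, one_mul] at h2
  convert! h2 using 2 with p
  by_cases hp : p.2 ∈ nearPts y
  · simp [hp]
  · have h3 : profile p.1 (y - latticePt p.2) = 0 := by
      by_contra hne
      exact hp (mem_nearPts_of_abs_le (abs_le_of_profile_ne_zero hne))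
    simp [hf, h3]

/-- The cube that contains the supports of all profiles. -/
def cube (n : ℕ) : Set (E n) := {x | ∀ i, |x i| ≤ 51 / 100}

theorem measurableSet_cube : MeasurableSet (cube n) := by
  simp only [cube, ofPred_forall]
  exact (isClosed_iInter fun i => isClosed_le (by fun_prop) continuous_const).measurableSet

theorem volume_cube_ne_top : volume (cube n) ≠ ⊤ :=
  ne_top_of_le_ne_top (isCompact_closedBall (0 : E n) (n + 1)).measure_lt_top.ne
    (measure_mono fun _ hx => mem_closedBall_zero_iff.2 (norm_le_of_abs_le hx))

theorem tsum_cube_indicator_le (y : E n) :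
    ∑' l : Fin n → ℤ, (cube n).indicator (1 : E n → ℝ≥0∞) (y - latticePt l) ≤ 2 ^ n := by
  have h0 : ∀ l ∉ nearPts y, (cube n).indicator (1 : E n → ℝ≥0∞) (y - latticePt l) = 0 :=
    fun l hl => Set.indicator_of_notMem
      (fun hm : y - latticePt l ∈ cube n => hl (mem_nearPts_of_abs_le hm)) _
  rw [tsum_eq_sum h0]
  calc _ ≤ ∑ _l ∈ nearPts y, (1 : ℝ≥0∞) :=
        Finset.sum_le_sum fun l _ =>
          Set.indicator_le_self' (f := (1 : E n → ℝ≥0∞)) (by simp) (y - latticePt l)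
    _ = (nearPts y).card := by simp
    _ ≤ 2 ^ n := by exact_mod_cast card_nearPts_le y

theorem tsum_prod_mul_le {κ : Type*} (w : ℕ → ℝ≥0∞) {I : κ → ℝ≥0∞} {A : ℝ≥0∞}
    (hI : ∑' l, I l ≤ A) : ∑' p : ℕ × κ, w p.1 * I p.2 ≤ (∑' j, w j) * A := by
  rw [ENNReal.tsum_prod (f := fun j l => w j * I l)]
  simp_rw [ENNReal.tsum_mul_left]
  rw [ENNReal.tsum_mul_right]
  gcongr

/-- Cauchy-Schwarz with weights w_j I_l: summability of `w` handles the sum over j, bounded overlap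
of the cells the sum over l. -/
theorem enorm_sq_le_weighted_tsum {κ : Type*} {w : ℕ → ℝ≥0∞} {I : κ → ℝ≥0∞} {A : ℝ≥0∞}
    {b : ℕ × κ → ℝ≥0∞} {P : ℕ × κ → ℂ} {F : Finset (ℕ × κ)} {z : ℂ}
    (hw0 : ∀ j, w j ≠ 0) (hwt : ∀ j, w j ≠ ⊤) (hP : ∀ p, ‖P p‖ₑ ≤ b p * I p.2)
    (hz : HasSum (fun p : {p // p ∉ F} => P p) z) (hI : ∑' l, I l ≤ A) :
    ‖z‖ₑ ^ 2 ≤ (∑' j, w j) * A * ∑' p : {p // p ∉ F}, (w p.1.1)⁻¹ * b p ^ 2 * I p.1.2 := by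
  have hcoef : ∀ j (d : ℝ≥0∞), w j * ((w j)⁻¹ * d) = d := fun j d => by
    rw [← mul_assoc, ENNReal.mul_inv_cancel (hw0 j) (hwt j), one_mul]
  have h1 : ‖z‖ₑ ≤ ∑' p : {p // p ∉ F}, (w p.1.1 * I p.1.2) * ((w p.1.1)⁻¹ * b p) := by
    refine (enorm_le_tsum hz).trans (ENNReal.tsum_le_tsum fun p => ?_)
    rw [mul_right_comm, hcoef]
    exact hP p
  have h2 : ∑' p : {p // p ∉ F}, w p.1.1 * I p.1.2 ≤ (∑' j, w j) * A :=
    (ENNReal.tsum_comp_le_tsum_of_injective Subtype.val_injective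
      fun p : ℕ × κ => w p.1 * I p.2).trans (tsum_prod_mul_le w hI)
  refine (pow_le_pow_left' h1 2).trans ((tsum_mul_sq_le _ _).trans
    (mul_le_mul' h2 (ENNReal.tsum_le_tsum fun p => le_of_eq ?_)))
  calc w p.1.1 * I p.1.2 * ((w p.1.1)⁻¹ * b p) ^ 2
      = w p.1.1 * ((w p.1.1)⁻¹ * ((w p.1.1)⁻¹ * b p ^ 2 * I p.1.2)) := by ring
    _ = _ := hcoef _ _

theorem lintegral_mul_tsum_mul {κ : Type*} [Countable κ] {J : κ → E n → ℝ≥0∞} {V W : ℝ≥0∞}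
    (hW : W ≠ ⊤) (d : κ → ℝ≥0∞) (hJ : ∀ p, Measurable (J p)) (hV : ∀ p, ∫⁻ x, J p x = V) :
    ∫⁻ x, W * ∑' p, d p * J p x = W * V * ∑' p, d p := by
  rw [lintegral_const_mul' _ _ hW, lintegral_tsum fun p => ((hJ p).const_mul _).aemeasurable]
  simp_rw [lintegral_const_mul _ (hJ _), hV]
  rw [ENNReal.tsum_mul_right]
  ring

/-- A series of functions living on the lattice translates of a cube converges in `L²`
unconditionally if it converges pointwise and its coefficients are square summable with a
weight. -/
theorem tendsto_eLpNorm_sub_sum {v : E n → ℂ} {P : ℕ × (Fin n → ℤ) → E n → ℂ}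
    {b : ℕ × (Fin n → ℤ) → ℝ≥0∞} {w : ℕ → ℝ≥0∞} {c : E n}
    (hP : ∀ p x, ‖P p x‖ₑ ≤ b p * (cube n).indicator (1 : E n → ℝ≥0∞) (x + c - latticePt p.2))
    (hv : ∀ᵐ x, HasSum (fun p => P p x) (v x))
    (hw0 : ∀ j, w j ≠ 0) (hwt : ∀ j, w j ≠ ⊤) (hw : ∑' j, w j ≠ ⊤)
    (hb : ∑' p, (w p.1)⁻¹ * b p ^ 2 ≠ ⊤) :
    Tendsto (fun F : Finset (ℕ × (Fin n → ℤ)) =>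
      eLpNorm (fun x => v x - ∑ p ∈ F, P p x) 2 volume) atTop (𝓝 0) := by
  set I : (Fin n → ℤ) → E n → ℝ≥0∞ := fun l x =>
    (cube n).indicator (1 : E n → ℝ≥0∞) (x + c - latticePt l) with hI
  have hIm : ∀ l, Measurable (I l) := fun l =>
    (measurable_one.indicator measurableSet_cube).comp (by fun_prop)
  have hIint : ∀ l, ∫⁻ x, I l x = volume (cube n) := by
    intro l
    simp only [hI, add_sub_assoc]
    rw [lintegral_add_right_eq_self (fun x => (cube n).indicator (1 : E n → ℝ≥0∞) x),
      lintegral_indicator_one measurableSet_cube]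
  have hI2 : ∀ l x, I l x ≤ 1 := fun l x => Set.indicator_le_self' (by simp) _
  set W : ℝ≥0∞ := (∑' j, w j) * 2 ^ n with hW
  have hWt : W ≠ ⊤ := by finiteness
  have hpt : ∀ F : Finset (ℕ × (Fin n → ℤ)), ∀ᵐ x, ‖v x - ∑ p ∈ F, P p x‖ₑ ^ 2 ≤
      W * ∑' p : {p // p ∉ F}, (w p.1.1)⁻¹ * b p ^ 2 * I p.1.2 x := by
    intro F
    filter_upwards [hv] with x hx
    -- The remainder is the series over the complement of F, so every partial-sum error is bounded
    -- by a tail of one convergent series; this yields unconditional convergence.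
    have h1 : HasSum (fun p : {p // p ∉ F} => P p x) (v x - ∑ p ∈ F, P p x) :=
      (F.hasSum_compl_iff (f := fun p => P p x)).2 (by simpa using hx)
    exact enorm_sq_le_weighted_tsum hw0 hwt (I := fun l => I l x) (fun p => hP p x) h1
      (tsum_cube_indicator_le (x + c))
  have hL : ∀ F : Finset (ℕ × (Fin n → ℤ)),
      eLpNorm (fun x => v x - ∑ p ∈ F, P p x) 2 volume ≤
      (W * volume (cube n) * ∑' p : {p // p ∉ F}, (w p.1.1)⁻¹ * b p ^ 2) ^ (1 / 2 : ℝ) := by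
    intro F
    rw [eLpNorm_eq_lintegral_rpow_enorm_toReal (by norm_num) (by norm_num)]
    simp only [ENNReal.toReal_ofNat, ENNReal.rpow_ofNat]
    gcongr
    refine (lintegral_mono_ae (hpt F)).trans_eq ?_
    exact lintegral_mul_tsum_mul hWt (fun p : {p // p ∉ F} => (w p.1.1)⁻¹ * b p ^ 2)
      (fun p => hIm p.1.2) (fun p => hIint p.1.2)
  have h0 : Tendsto (fun F : Finset (ℕ × (Fin n → ℤ)) =>
      (W * volume (cube n) * ∑' p : {p // p ∉ F}, (w p.1.1)⁻¹ * b p ^ 2) ^ (1 / 2 : ℝ))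
      atTop (𝓝 0) := by
    have h1 := ENNReal.tendsto_tsum_compl_atTop_zero hb
    have h2 := ENNReal.Tendsto.const_mul (a := W * volume (cube n)) h1
      (Or.inr (ENNReal.mul_ne_top hWt volume_cube_ne_top))
    have h3 := h2.ennrpow_const (1 / 2 : ℝ)
    simpa using h3
  exact tendsto_of_tendsto_of_tendsto_of_le_of_le tendsto_const_nhds h0 (fun _ => zero_le) hL

theorem norm_packet (ξ₀ : E n) (a : ℝ → ℂ) (χ : E n → ℂ) (k : Fin n → ℤ) (t : ℝ) (x : E n) :
    ‖packet ξ₀ a χ k t x‖ = ‖a t‖ * ‖χ (x + (2 * t) • ξ₀ - latticePt k)‖ := by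
  rw [packet, norm_mul, norm_mul, norm_mul, Complex.norm_exp, Complex.norm_exp,
    sub_sub_eq_add_sub]
  simp [← Complex.ofReal_pow]

/-- Frequency localization makes `u t` equal almost everywhere to its inverse Fourier integral;
multiplying the glued Taylor expansion by the modulations recovers it. -/
theorem hasSum_packet {ψ : ℝ → ℝ} {ρ R : ℝ} (hψ : Continuous ψ) (hs : ∀ η, ρ < |η| → ψ η = 0)
    (h1 : ∀ η, |η| ≤ R → ψ η = 1) {ξ₀ : E n} {u : ℝ → L2 n} {t : ℝ}
    (hu : ∀ᵐ ζ : E n, R < ‖(2 * Real.pi) • ζ - ξ₀‖ → (𝓕 (u t) : L2 n) ζ = 0) :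
    ∀ᵐ x, HasSum (fun p : (Fin n → ℕ) × (Fin n → ℤ) =>
      packet ξ₀ (taylorCoeff ψ p.1 p.2 ξ₀ u) (profile p.1) p.2 t x) (u t x) := by
  have h2 := fourierInv_ae_eq (𝓕 (u t) : L2 n) (integrable_fourier_of_localized hu)
  rw [FourierTransform.fourierInv_fourier_eq] at h2
  filter_upwards [h2] with x hx
  have h3 := (hasSum_mul_profile (y := x + (2 * t) • ξ₀)
    fun l => hasSum_taylorCoeff hψ hs h1 hu l x).mul_left
    (Complex.exp (Complex.I * (inner ℝ x ξ₀ : ℝ)) * Complex.exp (Complex.I * t * (‖ξ₀‖ : ℂ) ^ 2))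
  convert! h3 using 1
  · ext p
    rw [packet, sub_sub_eq_add_sub]
    ring
  · rw [← hx, Complex.exp_neg, Complex.exp_neg]
    field_simp

end

/-! ### Assembly of the constants and the series. -/

section

variable {n : ℕ}

theorem enorm_packet_profile_le (ξ₀ : E n) (a : ℝ → ℂ) (α : Fin n → ℕ) (k : Fin n → ℤ) (t : ℝ)
    (x : E n) : ‖packet ξ₀ a (profile α) k t x‖ₑ ≤
      ‖a t‖ₑ * (cube n).indicator (1 : E n → ℝ≥0∞) (x + (2 * t) • ξ₀ - latticePt k) := by
  rw [← ofReal_norm, norm_packet, ENNReal.ofReal_mul (norm_nonneg _), ofReal_norm, ofReal_norm]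
  gcongr
  by_cases hx : x + (2 * t) • ξ₀ - latticePt k ∈ cube n
  · rw [Set.indicator_of_mem hx, Pi.one_apply, ← ofReal_norm, ENNReal.ofReal_le_one]
    exact norm_profile_le _ _
  · have h0 : profile α (x + (2 * t) • ξ₀ - latticePt k) = 0 := by
      by_contra hne
      exact hx fun i => abs_le_of_profile_ne_zero hne i
    rw [h0, enorm_zero]
    exact zero_le

/-- The Taylor size `w` serves both as the Cauchy-Schwarz weight and as the rate of decay, so w_j⁻¹
· w_j² = w_j remains, which is summable. -/
theorem tsum_inv_mul_sq_ne_top {κ : Type*} {w : ℕ → ℝ} {K : ℝ} {A : ℝ≥0∞} {b : ℕ → κ → ℝ≥0∞}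
    (hK : 0 ≤ K) (hA : A ≠ ⊤) (hwpos : ∀ j, 0 < w j) (hwsum : Summable w)
    (hb : ∀ j, ∑' k, b j k ^ 2 ≤ ENNReal.ofReal (K * w j ^ 2) * A) :
    ∑' p : ℕ × κ, (ENNReal.ofReal (w p.1))⁻¹ * b p.1 p.2 ^ 2 ≠ ⊤ := by
  rw [ENNReal.tsum_prod (f := fun j k => (ENNReal.ofReal (w j))⁻¹ * b j k ^ 2)]
  refine ne_top_of_le_ne_top (ENNReal.mul_ne_top
    (ENNReal.mul_ne_top (ENNReal.ofReal_ne_top (r := K))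
      (ENNReal.ofReal_ne_top (r := ∑' j, w j))) hA) ?_
  rw [ENNReal.ofReal_tsum_of_nonneg (fun j => (hwpos j).le) hwsum, ← ENNReal.tsum_mul_left,
    ← ENNReal.tsum_mul_right]
  refine ENNReal.tsum_le_tsum fun j => ?_
  rw [ENNReal.tsum_mul_left]
  calc (ENNReal.ofReal (w j))⁻¹ * ∑' k, b j k ^ 2
      ≤ (ENNReal.ofReal (w j))⁻¹ * (ENNReal.ofReal (K * w j ^ 2) * A) := by
        gcongr
        exact hb j
    _ = ENNReal.ofReal K * ENNReal.ofReal (w j) * A := by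
        have hpos := hwpos j
        rw [← mul_assoc, ← ENNReal.ofReal_inv_of_pos hpos,
          ← ENNReal.ofReal_mul (by positivity), ← ENNReal.ofReal_mul hK]
        congr 2
        field_simp

theorem tendsto_eLpNorm_sub_sum_packet {ψ : ℝ → ℝ} {ρ R : ℝ} (hψ : Continuous ψ)
    (hs : ∀ η, ρ < |η| → ψ η = 0) (h1 : ∀ η, |η| ≤ R → ψ η = 1) {ξ₀ : E n} {u : ℝ → L2 n} {t : ℝ}
    (ht : t ∈ Icc (0 : ℝ) 1)
    (hu : ∀ᵐ ζ : E n, R < ‖(2 * Real.pi) • ζ - ξ₀‖ → (𝓕 (u t) : L2 n) ζ = 0)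
    (e : ℕ ≃ (Fin n → ℕ)) {w : ℕ → ℝ} {K : ℝ} {A : ℝ≥0∞}
    (hK : 0 ≤ K) (hA : A ≠ ⊤) (hwpos : ∀ j, 0 < w j) (hwsum : Summable w)
    (hl2 : ∀ j, ∑' k, v2NormSq (taylorCoeff ψ (e j) k ξ₀ u) ≤ ENNReal.ofReal (K * w j ^ 2) * A) :
    Tendsto (fun F : Finset (ℕ × (Fin n → ℤ)) =>
      eLpNorm (fun x => u t x -
        ∑ p ∈ F, packet ξ₀ (taylorCoeff ψ (e p.1) p.2 ξ₀ u) (profile (e p.1)) p.2 t x) 2 volume)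
      atTop (𝓝 0) := by
  refine tendsto_eLpNorm_sub_sum (c := (2 * t) • ξ₀)
    (P := fun p => packet ξ₀ (taylorCoeff ψ (e p.1) p.2 ξ₀ u) (profile (e p.1)) p.2 t)
    (b := fun p => ‖taylorCoeff ψ (e p.1) p.2 ξ₀ u t‖ₑ)
    (w := fun j => ENNReal.ofReal (w j)) (fun p x => enorm_packet_profile_le _ _ _ _ _ _) ?_
    (fun j => (ENNReal.ofReal_pos.2 (hwpos j)).ne') (fun j => ENNReal.ofReal_ne_top) ?_ ?_
  · filter_upwards [hasSum_packet hψ hs h1 hu] with x hx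
    exact (e.prodCongr (Equiv.refl (Fin n → ℤ))).hasSum_iff.2 hx
  · rw [← ENNReal.ofReal_tsum_of_nonneg (fun j => (hwpos j).le) hwsum]
    exact ENNReal.ofReal_ne_top
  · exact tsum_inv_mul_sq_ne_top (b := fun j k => ‖taylorCoeff ψ (e j) k ξ₀ u t‖ₑ) hK hA hwpos
      hwsum fun j => (ENNReal.tsum_le_tsum fun k => enorm_sq_le_v2NormSq _ ht).trans (hl2 j)

theorem le_mul_div_pow {S A c : ℝ≥0∞} {r B : ℝ} {j N : ℕ} (hS : S ≤ ENNReal.ofReal r * A)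
    (hr : 0 ≤ r) (hB : r * ((j : ℝ) + 1) ^ N ≤ B) :
    S ≤ (c + ENNReal.ofReal B) * A / ((j : ℝ≥0∞) + 1) ^ N := by
  have hj : ((j : ℝ≥0∞) + 1) ^ N = ENNReal.ofReal (((j : ℝ) + 1) ^ N) := by
    rw [ENNReal.ofReal_pow (by positivity), ENNReal.ofReal_add (by positivity) (by positivity)]
    simp
  refine hS.trans ?_
  rw [ENNReal.le_div_iff_mul_le (Or.inl (by positivity)) (Or.inl (by finiteness)), hj,
    mul_right_comm, ← ENNReal.ofReal_mul hr]
  gcongr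
  exact le_add_left (ENNReal.ofReal_le_ofReal hB)

theorem exists_contDiff_cutoff {R : ℝ} (hR : 0 < R) : ∃ ψ : ℝ → ℝ, ContDiff ℝ ∞ ψ ∧
    (∀ η, R + 1 < |η| → ψ η = 0) ∧ ∀ η, |η| ≤ R → ψ η = 1 := by
  -- The outer radius R + 1 exceeds 1 for every R > 0, as the kernel estimate requires.
  let f : ContDiffBump (0 : ℝ) := ⟨R, R + 1, hR, by linarith⟩
  exact ⟨f, f.contDiff, fun η hη => f.zero_of_le_dist (by simpa using hη.le),
    fun η hη => f.one_of_mem_closedBall (by simpa using hη)⟩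

end

end WavePacket
end

theorem mainTheorem11 (n : ℕ) (hn : 1 ≤ n) (φ : WavePacket.E n → ℝ)
    (hφ : WavePacket.IsLatticePartition φ) (R : ℝ) (hR : 0 < R) :
    ∃ (χ : ℕ → WavePacket.E n → ℂ) (C : ℕ → ℝ≥0),
      (∀ j, ContDiff ℝ ∞ (χ j)) ∧
      (∀ j, HasCompactSupport (χ j)) ∧
      (∀ j, tsupport (χ j) ⊆ {x | (∀ i, |x i| < 2) ∧ (n ≤ 15 → ‖x‖ < 2)}) ∧
      (∀ N j, WavePacket.hNorm N (WavePacket.toL2 (χ j)) ≤ C N) ∧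
      ∀ (ξ₀ : WavePacket.E n) (u : ℝ → WavePacket.L2 n),
        WavePacket.MemX φ u → WavePacket.FrequencyLocalized R ξ₀ u →
        ∃ a : ℕ → (Fin n → ℤ) → ℝ → ℂ,
          (∀ j k, WavePacket.MemV2 (a j k)) ∧
          (WavePacket.MemXClosure φ u → ∀ j k, WavePacket.MemV2Closure (a j k)) ∧
          (∀ t ∈ Icc (0 : ℝ) 1,
            Tendsto (fun F : Finset (ℕ × (Fin n → ℤ)) =>
              eLpNorm (fun x => u t x -
                ∑ p ∈ F, WavePacket.packet ξ₀ (a p.1 p.2) (χ p.1) p.2 t x) 2 volume)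
              atTop (𝓝 0)) ∧
          (∀ N j, ∑' k, WavePacket.v2NormSq (a j k)
            ≤ C N * WavePacket.xNormSq φ u / ((j : ℝ≥0∞) + 1) ^ N) := by
  obtain ⟨e, p, -, he⟩ := WavePacket.exists_multiIndex_equiv hn
  obtain ⟨f, hψ, hs, h1⟩ := WavePacket.exists_contDiff_cutoff hR
  obtain ⟨K, hK, hcoeff⟩ := WavePacket.exists_taylorCoeff_bound hφ hψ (by linarith) hs
  have hΛ : 0 < 2 * (R + 1) := by linarith
  choose C₁ hC₁ using WavePacket.exists_hNorm_profile_bound n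
  -- The exponent p * N converts decay in |α| to decay in j, since j + 1 ≤ (|α| + 1)^p.
  choose B hB0 hB using fun N => WavePacket.exists_taylorSize_decay (n := n) hΛ (p * N)
  -- One constant serves both claims: the first summand bounds the profiles, the second the decay of
  -- the amplitudes.
  refine ⟨fun j => WavePacket.profile (e.symm j), fun N => C₁ N + (K * B N).toNNReal,
    fun j => WavePacket.contDiff_profile _, fun j => WavePacket.hasCompactSupport_profile _,
    fun j => WavePacket.tsupport_profile_subset_ball _, fun N j => ?_, fun ξ₀ u hu hloc => ?_⟩
  · refine (hC₁ N (e.symm j)).trans ?_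
    push_cast
    exact le_self_add
  have hc := hcoeff ξ₀ u hu
  have hl2 : ∀ j, ∑' k, WavePacket.v2NormSq (WavePacket.taylorCoeff f (e.symm j) k ξ₀ u) ≤
      ENNReal.ofReal (K * WavePacket.taylorSize (2 * (R + 1)) (e.symm j) ^ 2) *
        WavePacket.xNormSq φ u := fun j => (hc (e.symm j)).2.2
  refine ⟨fun j k => WavePacket.taylorCoeff f (e.symm j) k ξ₀ u, fun j k => (hc _).1 k,
    fun hcl j k => (hc _).2.1 hcl k, fun t ht => ?_, fun N j => ?_⟩
  · exact WavePacket.tendsto_eLpNorm_sub_sum_packet hψ.continuous hs h1 ht (hloc t ht) e.symm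
      (w := fun j => WavePacket.taylorSize (2 * (R + 1)) (e.symm j)) hK hu.2.ne
      (fun j => WavePacket.taylorSize_pos hΛ _)
      ((WavePacket.summable_taylorSize (2 * (R + 1))).comp_injective e.symm.injective) hl2
  · have hj : ((j : ℝ) + 1) ^ N ≤ ((∑ i, e.symm j i + 1 : ℕ) : ℝ) ^ (p * N) := by
      rw [pow_mul]
      gcongr
      have := he (e.symm j)
      rw [Equiv.apply_symm_apply] at this
      exact_mod_cast this
    push_cast
    refine WavePacket.le_mul_div_pow (hl2 j) (by positivity) ?_
    rw [mul_assoc]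
    gcongr
    exact (mul_le_mul_of_nonneg_left hj (sq_nonneg _)).trans (hB N (e.symm j))
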